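/- **Conventions.** All monoids are commutative with unit. A prime ideal of a monoid $A$ is a subset $\mathfrak p\subset A$ (possibly empty) with $A\mathfrak p\subset\mathfrak p$ whose complement $A\setminus\mathfrak p$ is a submonoid. The set $\mathrm{spec}(A)$ of all prime ideals carries the Zariski topology and the structure sheaf of functions that are locally fractions in the localisations $A_{\mathfrak p}=(A\setminus\mathfrak p)^{-1}A$. A scheme over $\mathbb F_1$ is a topological space with a sheaf of monoids that is locally isomorphic to spectra of monoids. It is of finite type if it has a finite covering by open subsets isomorphic to $\mathrm{spec}(A_i)$ with $A_i$ finitely generated. The scheme $X_{\mathbb Z}$ is glued from the affine schemes $\mathrm{Spec}\,\mathbb Z[A]$, where $\mathrm{spec}(A)$ runs through the affine open subsets of $X$. For a scheme $X$ over $\mathbb F_1$ of finite type, the stalk unit groups $\mathcal O_{X,x}^\times$ $(x\in X)$ are finitely generated abelian groups. Let the exponent of $X$ be the least common multiple of the exponents of their torsion subgroups, and let the rank of $X$ be the maximum of their ranks, over all points $x$ of the finite set $X$ (exponent $1$ and rank $0$ if $X=\emptyset$). **Theorem.** Let $X$ be a scheme over $\mathbb F_1$ of finite type. Then $X_{\mathbb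 Z}(K)$ is finite for every finite field $K$, and there are a positive integer $e$ and a polynomial $N\in\mathbb Z[x]$ such that for every prime power $q$ $$\gcd(q-1,e)=1\ \Longrightarrow\ \#X_{\mathbb Z}(\mathbb F_q)=N(q).$$ This condition determines $N$ uniquely, independently of the choice of $e$: if $e'\ge 1$ and $N'\in\mathbb Z[x]$ also satisfy it, then $N'=N$. The polynomial $N$ is called the zeta-polynomial of $X$. One can take $e$ to be the exponent of $X$, and $\deg N$ is at most the rank of $X$. -/

import Mathlib

universe u

noncomputable section

namespace FOne

open CategoryTheory TopologicalSpace Opposite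

/-! ## Prime ideals of a commutative monoid and the spectrum -/

/-- A prime ideal of a commutative monoid `A`: a subset `𝔭` with `A𝔭 ⊆ 𝔭` whose complement is a
submonoid. The empty set is a prime ideal. -/
@[ext]
structure Prime (A : Type u) [CommMonoid A] where
  /-- the underlying subset -/
  carrier : Set A
  mul_mem : ∀ a x : A, x ∈ carrier → a * x ∈ carrier
  one_notMem : (1 : A) ∉ carrier
  mul_notMem : ∀ a b : A, a ∉ carrier → b ∉ carrier → a * b ∉ carrier

namespace Prime

section
variable {A : Type u} [CommMonoid A] {B : Type u} [CommMonoid B]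

/-- The submonoid `A ∖ 𝔭`. -/
def compl (p : Prime A) : Submonoid A where
  carrier := p.carrierᶜ
  one_mem' := p.one_notMem
  mul_mem' := fun {a b} ha hb => p.mul_notMem a b ha hb

theorem mem_compl {p : Prime A} {a : A} : a ∈ p.compl ↔ a ∉ p.carrier := Iff.rfl

theorem compl_of_mul_left {p : Prime A} {a b : A} (h : a * b ∈ p.compl) : b ∈ p.compl :=
  fun hb => h (p.mul_mem a b hb)

theorem compl_of_mul_right {p : Prime A} {a b : A} (h : a * b ∈ p.compl) : a ∈ p.compl :=
  compl_of_mul_left (by rwa [mul_comm] at h)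

theorem mul_mem_compl {p : Prime A} {a b : A} :
    a * b ∈ p.compl ↔ a ∈ p.compl ∧ b ∈ p.compl :=
  ⟨fun h => ⟨compl_of_mul_right h, compl_of_mul_left h⟩, fun h => p.compl.mul_mem h.1 h.2⟩

/-- The basic open set `D(f)` of all primes that do not contain `f`. -/
def basic (f : A) : Set (Prime A) := {p | f ∉ p.carrier}

/-- The Zariski topology: the closed sets are the sets of all primes that contain a given subset
of `A`; in other words, the topology generated by the basic open sets. -/
instance : TopologicalSpace (Prime A) := generateFrom (Set.range basic)

theorem isOpen_basic (f : A) : IsOpen (basic f) := isOpen_generateFrom_of_mem ⟨f, rfl⟩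

theorem mem_basic {f : A} {p : Prime A} : p ∈ basic f ↔ f ∈ p.compl := Iff.rfl

theorem basic_mul (f g : A) : basic (f * g) = basic f ∩ basic g := by
  ext p; exact mul_mem_compl

theorem basic_one : basic (1 : A) = Set.univ :=
  Set.eq_univ_of_forall fun p => p.one_notMem

theorem isBasis_basic : IsTopologicalBasis (Set.range (basic (A := A))) where
  exists_subset_inter := by
    rintro _ ⟨f, rfl⟩ _ ⟨g, rfl⟩ p hp
    exact ⟨_, ⟨f * g, rfl⟩, by rwa [basic_mul], by rw [basic_mul]⟩
  sUnion_eq := Set.eq_univ_of_forall fun p => ⟨_, ⟨1, rfl⟩, p.one_notMem⟩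
  eq_generateFrom := rfl

theorem isOpen_iff {U : Set (Prime A)} :
    IsOpen U ↔ ∃ s : Set A, U = {p | s ⊆ p.carrier}ᶜ := by
  constructor
  · intro hU
    refine ⟨{f | basic f ⊆ U}, ?_⟩
    ext p
    constructor
    · intro hp hs
      obtain ⟨_, ⟨f, rfl⟩, hpf, hf⟩ := isBasis_basic.exists_subset_of_mem_open hp hU
      exact hpf (hs hf)
    · intro hp
      obtain ⟨f, hf, hpf⟩ := Set.not_subset.mp hp
      exact hf hpf
  · rintro ⟨s, rfl⟩
    have : ({p : Prime A | s ⊆ p.carrier}ᶜ) = ⋃ f ∈ s, basic f := by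
      ext p
      simp [Set.not_subset, basic]
    rw [this]
    exact isOpen_biUnion fun f _ => isOpen_basic f

/-- The preimage of a prime ideal under a homomorphism. -/
def comap (φ : A →* B) (q : Prime B) : Prime A where
  carrier := φ ⁻¹' q.carrier
  mul_mem a x hx := by
    simpa using q.mul_mem (φ a) (φ x) hx
  one_notMem := by simpa using q.one_notMem
  mul_notMem a b ha hb := by simpa using q.mul_notMem (φ a) (φ b) ha hb

theorem mem_comap_compl {φ : A →* B} {q : Prime B} {a : A} :
    a ∈ (comap φ q).compl ↔ φ a ∈ q.compl := Iff.rfl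

theorem continuous_comap (φ : A →* B) : Continuous (comap φ) := by
  refine continuous_generateFrom_iff.mpr ?_
  rintro _ ⟨f, rfl⟩
  exact isOpen_basic (φ f)

/-- The largest prime ideal in `D(f)`: all elements that divide no power of `f`. -/
def away (f : A) : Prime A where
  carrier := {a | ¬ ∃ n : ℕ, a ∣ f ^ n}
  mul_mem a x hx := by
    rintro ⟨n, hn⟩
    exact hx ⟨n, (dvd_mul_left x a).trans hn⟩
  one_notMem h := h ⟨0, one_dvd _⟩
  mul_notMem a b ha hb := by
    simp only [Set.mem_ofPred_eq, not_not] at ha hb ⊢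
    obtain ⟨n, hn⟩ := ha
    obtain ⟨m, hm⟩ := hb
    exact ⟨n + m, by rw [pow_add]; exact mul_dvd_mul hn hm⟩

theorem mem_away_compl {f a : A} : a ∈ (away f).compl ↔ ∃ n : ℕ, a ∣ f ^ n := not_not

theorem away_mem (f : A) : away f ∈ basic f := mem_away_compl.mpr ⟨1, by simp⟩

theorem compl_away_le {f : A} {p : Prime A} (hp : p ∈ basic f) : (away f).compl ≤ p.compl := by
  intro a ha
  obtain ⟨n, c, hc⟩ := mem_away_compl.mp ha
  have : f ^ n ∈ p.compl := pow_mem hp n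
  rw [hc] at this
  exact compl_of_mul_right this

/-- An open set that contains the largest prime of `D(f)` contains `D(f)`. -/
theorem basic_subset {f : A} {U : Set (Prime A)} (hU : IsOpen U) (h : away f ∈ U) :
    basic f ⊆ U := by
  obtain ⟨_, ⟨g, rfl⟩, hg, hgU⟩ := isBasis_basic.exists_subset_of_mem_open h hU
  exact fun p hp => hgU (compl_away_le hp hg)

end

end Prime

/-! ## The structure sheaf -/

section Sheaf

variable (A : Type u) [CommMonoid A]

/-- The spectrum of a monoid as a topological space. -/
abbrev specTop : TopCat.{u} := TopCat.of (Prime A)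

variable {A}

/-- The localisation `A_𝔭 = (A ∖ 𝔭)⁻¹ A`. -/
abbrev Loc (p : Prime A) : Type u := Localization p.compl

/-- A function on `U` with values in the localisations is a fraction if it is
`𝔭 ↦ a / s ∈ A_𝔭` for fixed elements `a`, `s` of `A`, with `s ∉ 𝔭` for every `𝔭 ∈ U`. -/
def isFraction : TopCat.PrelocalPredicate (X := specTop A) (fun p : Prime A => Loc p) where
  pred {U} f := ∃ a s : A, ∀ p : U, ∃ hs : s ∈ Prime.compl p.1, f p = Localization.mk a ⟨s, hs⟩
  res := by rintro V U i f ⟨a, s, h⟩; exact ⟨a, s, fun p => h ⟨p.1, i.le p.2⟩⟩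

/-- The functions that are locally a fraction. -/
def isLocallyFraction : TopCat.LocalPredicate (X := specTop A) (fun p : Prime A => Loc p) :=
  isFraction.sheafify

/-- The monoid `𝒪(U)` of all functions on `U` that are locally a fraction. -/
def sections (U : Opens (specTop A)) : Submonoid (∀ p : U, Loc (A := A) p.1) where
  carrier := {f | isLocallyFraction.pred f}
  one_mem' p := ⟨U, p.2, 𝟙 _, 1, 1, fun q => ⟨one_mem _, Localization.mk_one.symm⟩⟩
  mul_mem' {f g} hf hg p := by
    obtain ⟨V, hV, i, a, s, h⟩ := hf p
    obtain ⟨W, hW, j, b, t, k⟩ := hg p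
    refine ⟨V ⊓ W, ⟨hV, hW⟩, Opens.infLELeft _ _ ≫ i, a * b, s * t, fun q => ?_⟩
    obtain ⟨hs, hf⟩ := h ⟨q.1, q.2.1⟩
    obtain ⟨ht, hg⟩ := k ⟨q.1, q.2.2⟩
    exact ⟨mul_mem hs ht, congr($hf * $hg).trans (Localization.mk_mul ..)⟩

/-- Restriction of sections. -/
def sectionsRes {U V : Opens (specTop A)} (h : V ≤ U) : sections U →* sections V where
  toFun s := ⟨fun p => s.1 ⟨p.1, h p.2⟩, isLocallyFraction.res (homOfLE h) s.1 s.2⟩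
  map_one' := rfl
  map_mul' _ _ := rfl

variable (A) in
/-- The structure presheaf of the spectrum of a monoid. -/
def structurePresheaf : TopCat.Presheaf CommMonCat.{u} (specTop A) where
  obj U := CommMonCat.of (sections U.unop)
  map i := CommMonCat.ofHom (sectionsRes (leOfHom i.unop))

theorem structurePresheaf_isSheaf : (structurePresheaf A).IsSheaf :=
  (TopCat.Presheaf.isSheaf_iff_isSheaf_comp (forget CommMonCat) _).mpr
    (TopCat.Presheaf.isSheaf_of_iso
      (NatIso.ofComponents (fun _ => Iso.refl _) (fun _ => rfl))
      (TopCat.subsheafToTypes (isLocallyFraction (A := A))).2)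

end Sheaf

/-- A topological space with a sheaf of commutative monoids. -/
abbrev MonoidalSpace := AlgebraicGeometry.SheafedSpace.{u + 1, u, u} CommMonCat.{u}

/-- The spectrum of a commutative monoid, with its structure sheaf. -/
def spec (A : Type u) [CommMonoid A] : MonoidalSpace.{u} where
  carrier := specTop A
  presheaf := structurePresheaf A
  IsSheaf := structurePresheaf_isSheaf

/-! ### Sections over basic open sets -/

section Basic

variable {A : Type u} [CommMonoid A] {B : Type u} [CommMonoid B]

/-- The basic open set `D(f)` as an open subset of the spectrum. -/
def basicOpen (f : A) : Opens (specTop A) := ⟨Prime.basic f, Prime.isOpen_basic f⟩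

/-- The section of the structure sheaf that belongs to an element of the monoid. -/
def toSec (U : Opens (specTop A)) : A →* sections U where
  toFun a := ⟨fun _ => Localization.mk a 1, fun p => ⟨U, p.2, 𝟙 _, a, 1, fun _ => ⟨one_mem _, rfl⟩⟩⟩
  map_one' := Subtype.ext <| funext fun _ => Localization.mk_one
  map_mul' a b := Subtype.ext <| funext fun p => by
    refine Eq.trans ?_ (Localization.mk_mul a b (1 : Prime.compl p.1) 1).symm
    rw [mul_one]

theorem sectionsRes_toSec {U V : Opens (specTop A)} (h : V ≤ U) (a : A) :
    sectionsRes h (toSec U a) = toSec V a := rfl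

theorem mk_eq_iff {p : Prime A} {a b : A} {s t : p.compl} :
    (Localization.mk a s : Loc p) = Localization.mk b t ↔
      ∃ c ∈ p.compl, c * (t * a) = c * (s * b) := by
  rw [Localization.mk_eq_mk_iff, Localization.r_iff_exists]
  simp

theorem toSec_isLocalizationMap (f : A) {U : Opens (specTop A)} (hU : (U : Set (Prime A)) = Prime.basic f) :
    Submonoid.IsLocalizationMap (Submonoid.powers f) (toSec U) where
  map_units := by
    rintro ⟨_, n, rfl⟩
    have hf : ∀ p : U, f ∈ Prime.compl p.1 := fun p => by
      have := p.2
      rwa [← SetLike.mem_coe, hU] at this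
    dsimp only
    rw [map_pow]
    refine IsUnit.pow _ (isUnit_iff_exists_inv.mpr
      ⟨⟨fun p => Localization.mk 1 ⟨f, hf p⟩, fun p => ⟨U, p.2, 𝟙 _, 1, f, fun q => ⟨hf q, rfl⟩⟩⟩, ?_⟩)
    refine Subtype.ext <| funext fun p => ?_
    refine (Localization.mk_mul f 1 (1 : Prime.compl p.1) ⟨f, hf p⟩).trans ?_
    refine Eq.trans (mk_eq_iff.mpr ?_) Localization.mk_one
    exact ⟨1, one_mem _, by simp⟩
  surj s := by
    have hm : Prime.away f ∈ U := by rw [← SetLike.mem_coe, hU]; exact Prime.away_mem f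
    obtain ⟨V, hV, i, a, t, h⟩ := s.2 ⟨_, hm⟩
    have hUV : U ≤ V := fun p hp => by
      rw [← SetLike.mem_coe, hU] at hp
      exact Prime.basic_subset V.2 hV hp
    obtain ⟨n, c, hc⟩ := Prime.mem_away_compl.mp (h ⟨_, hV⟩).1
    refine ⟨⟨a * c, ⟨f ^ n, n, rfl⟩⟩, Subtype.ext <| funext fun p => ?_⟩
    obtain ⟨ht, hs⟩ := h ⟨p.1, hUV p.2⟩
    refine (congr($hs * Localization.mk (f ^ n) (1 : Prime.compl p.1))).trans ?_
    rw [Localization.mk_mul]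
    refine mk_eq_iff.mpr ⟨1, one_mem _, ?_⟩
    simp only [hc, mul_one, one_mul, Submonoid.coe_one]
    ac_rfl
  exists_of_eq {a b} h := by
    have hm : Prime.away f ∈ U := by rw [← SetLike.mem_coe, hU]; exact Prime.away_mem f
    obtain ⟨c, hc, e⟩ := mk_eq_iff.mp (congr_fun (congrArg Subtype.val h) ⟨_, hm⟩)
    obtain ⟨n, d, hd⟩ := Prime.mem_away_compl.mp hc
    refine ⟨⟨f ^ n, n, rfl⟩, ?_⟩
    simp only [Submonoid.coe_one, one_mul] at e
    simp only [hd]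
    rw [mul_comm c d, mul_assoc, mul_assoc, e]

theorem toSec_top_bijective : Function.Bijective (toSec (A := A) ⊤) := by
  have h := toSec_isLocalizationMap (1 : A) (U := ⊤) Prime.basic_one.symm
  constructor
  · intro a b hab
    obtain ⟨⟨_, n, rfl⟩, hc⟩ := h.exists_of_eq hab
    simpa using hc
  · intro s
    obtain ⟨⟨a, _, n, rfl⟩, hc⟩ := h.surj s
    exact ⟨a, by simpa using hc.symm⟩

/-- Transport of the property of being a localisation along bijections. -/
theorem isLocalizationMap_transport {M N M' N' : Type u} [CommMonoid M] [CommMonoid N]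
    [CommMonoid M'] [CommMonoid N'] {φ : M →* N} {ψ : M' →* N'} {α : M →* M'} {β : N →* N'}
    (hα : Function.Bijective α) (hβ : Function.Bijective β)
    (h : ∀ x, β (φ x) = ψ (α x)) (f : M)
    (H : Submonoid.IsLocalizationMap (Submonoid.powers f) φ) :
    Submonoid.IsLocalizationMap (Submonoid.powers (α f)) ψ where
  map_units := by
    rintro ⟨_, n, rfl⟩
    have := (H.map_units ⟨_, n, rfl⟩).map β
    simpa [h] using this
  surj z := by
    obtain ⟨z, rfl⟩ := hβ.2 z
    obtain ⟨⟨x, _, n, rfl⟩, hx⟩ := H.surj z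
    refine ⟨⟨α x, ⟨_, n, rfl⟩⟩, ?_⟩
    have := congrArg β hx
    simpa [h] using this
  exists_of_eq {x y} hxy := by
    obtain ⟨x, rfl⟩ := hα.2 x
    obtain ⟨y, rfl⟩ := hα.2 y
    rw [← h, ← h] at hxy
    obtain ⟨⟨_, n, rfl⟩, hc⟩ := H.exists_of_eq (hβ.1 hxy)
    refine ⟨⟨_, n, rfl⟩, ?_⟩
    have := congrArg α hc
    simpa using this

theorem sectionsRes_isLocalizationMap (f : A) :
    Submonoid.IsLocalizationMap (Submonoid.powers (toSec ⊤ f))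
      (sectionsRes (le_top : basicOpen f ≤ ⊤)) :=
  isLocalizationMap_transport (φ := toSec (basicOpen f)) (ψ := sectionsRes le_top) (α := toSec ⊤) (β := MonoidHom.id _) toSec_top_bijective
    Function.bijective_id (fun _ => rfl) f (toSec_isLocalizationMap f (U := basicOpen f) rfl)

/-! ### Functoriality; basic open sets are spectra -/

/-- The homomorphism `A_𝔭 → B_𝔮` induced by `φ : A → B` if `𝔭 = φ⁻¹(𝔮)`. -/
def locMap (φ : A →* B) (q : Prime B) : Loc (Prime.comap φ q) →* Loc q :=
  Submonoid.LocalizationMap.map (Localization.monoidOf (Prime.comap φ q).compl) (g := φ)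
    (T := q.compl) (fun y => y.2) (Localization.monoidOf q.compl)

theorem locMap_mk (φ : A →* B) (q : Prime B) (a : A) (s : (Prime.comap φ q).compl) :
    locMap φ q (Localization.mk a s) = Localization.mk (φ a) ⟨φ s, s.2⟩ := by
  simp only [locMap, Localization.mk_eq_monoidOf_mk']
  exact Submonoid.LocalizationMap.map_mk' (f := Localization.monoidOf (Prime.comap φ q).compl)
    (fun y => y.2) a s

/-- The continuous map of spectra induced by a homomorphism. -/
def specBase (φ : A →* B) : specTop B ⟶ specTop A :=
  TopCat.ofHom ⟨Prime.comap φ, Prime.continuous_comap φ⟩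

/-- Pull back sections along a homomorphism. -/
def sectionsComap (φ : A →* B) (U : Opens (specTop A)) :
    sections U →* sections ((Opens.map (specBase φ)).obj U) where
  toFun s := ⟨fun q => locMap φ q.1 (s.1 ⟨Prime.comap φ q.1, q.2⟩), fun q => by
    obtain ⟨V, hV, i, a, t, h⟩ := s.2 ⟨Prime.comap φ q.1, q.2⟩
    refine ⟨(Opens.map (specBase φ)).obj V, hV, (Opens.map (specBase φ)).map i, φ a, φ t,
      fun r => ?_⟩
    obtain ⟨ht, hs⟩ := h ⟨Prime.comap φ r.1, r.2⟩
    exact ⟨ht, congr(locMap φ r.1 $hs).trans (locMap_mk ..)⟩⟩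
  map_one' := Subtype.ext <| funext fun q => map_one (locMap φ q.1)
  map_mul' s t := Subtype.ext <| funext fun q => map_mul (locMap φ q.1) _ _

/-- The morphism of spectra induced by a homomorphism. -/
def specMap (φ : A →* B) : spec B ⟶ spec A :=
  InducedCategory.homMk
    { base := specBase φ
      c := { app := fun U => CommMonCat.ofHom (sectionsComap φ U.unop)
             naturality := fun _ _ _ => rfl } }

end Basic

section Localization

variable {A : Type u} [CommMonoid A] {B : Type u} [CommMonoid B] {φ : A →* B} {f : A}

theorem exists_mul_eq (H : Submonoid.IsLocalizationMap (Submonoid.powers f) φ) (b : B) :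
    ∃ (a : A) (n : ℕ), b * φ (f ^ n) = φ a := by
  obtain ⟨⟨a, _, n, rfl⟩, h⟩ := H.surj b
  exact ⟨a, n, h⟩

theorem map_pow_mem_compl (H : Submonoid.IsLocalizationMap (Submonoid.powers f) φ) (n : ℕ)
    (q : Prime B) : φ (f ^ n) ∈ q.compl := by
  obtain ⟨c, hc⟩ := isUnit_iff_exists_inv.mp (H.map_units ⟨_, n, rfl⟩)
  refine Prime.compl_of_mul_right (b := c) ?_
  rw [hc]
  exact one_mem _

theorem comap_injective (H : Submonoid.IsLocalizationMap (Submonoid.powers f) φ) :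
    Function.Injective (Prime.comap φ) := by
  have key : ∀ q q' : Prime B, Prime.comap φ q = Prime.comap φ q' → ∀ b, b ∈ q.compl → b ∈ q'.compl := by
    intro q q' h b hb
    obtain ⟨a, n, e⟩ := exists_mul_eq H b
    have h1 : a ∈ (Prime.comap φ q).compl := by
      rw [Prime.mem_comap_compl, ← e]
      exact mul_mem hb (map_pow_mem_compl H n q)
    rw [h, Prime.mem_comap_compl, ← e] at h1
    exact Prime.compl_of_mul_right h1
  intro q q' h
  ext b
  exact not_iff_not.mp ⟨key q q' h b, key q' q h.symm b⟩

theorem image_basic (H : Submonoid.IsLocalizationMap (Submonoid.powers f) φ) {a : A} {b : B} {n : ℕ}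
    (e : b * φ (f ^ n) = φ a) : Prime.comap φ '' Prime.basic b = Prime.basic (a * f) := by
  ext p
  constructor
  · rintro ⟨q, hq, rfl⟩
    rw [Prime.mem_basic, Prime.mem_comap_compl, map_mul, ← e]
    have := map_pow_mem_compl H 1 q
    rw [pow_one] at this
    exact mul_mem (mul_mem hq (map_pow_mem_compl H n q)) this
  · intro hp
    have hf : ∀ m : ℕ, f ^ m ∈ p.compl := fun m => pow_mem (Prime.compl_of_mul_left hp) m
    have ha : a ∈ p.compl := Prime.compl_of_mul_right hp
    have key : ∀ x y : A, φ x = φ y → x ∈ p.compl → y ∈ p.compl := by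
      intro x y hxy hx
      obtain ⟨⟨_, k, rfl⟩, hk⟩ := H.exists_of_eq hxy
      refine Prime.compl_of_mul_left (a := f ^ k) ?_
      change f ^ k * x = f ^ k * y at hk
      rw [← hk]
      exact mul_mem (hf k) hx
    let q : Prime B :=
      { carrier := {c | ¬ ∃ x m, x ∈ p.compl ∧ c * φ (f ^ m) = φ x}
        mul_mem := by
          rintro c d hd ⟨x, m, hx, hm⟩
          obtain ⟨y, k, hy⟩ := exists_mul_eq H d
          obtain ⟨z, l, hz⟩ := exists_mul_eq H c
          refine hd ⟨y, k, ?_, hy⟩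
          have : φ (x * f ^ k * f ^ l) = φ (z * y * f ^ m) := by
            simp only [map_mul, ← hm, ← hy, ← hz]
            ac_rfl
          have h1 := key _ _ this (mul_mem (mul_mem hx (hf k)) (hf l))
          exact Prime.compl_of_mul_left (Prime.compl_of_mul_right h1)
        one_notMem := fun h => h ⟨1, 0, one_mem _, by simp⟩
        mul_notMem := by
          rintro c d hc hd
          simp only [Set.mem_ofPred_eq, not_not] at hc hd ⊢
          obtain ⟨x, m, hx, hm⟩ := hc
          obtain ⟨y, k, hy, hk⟩ := hd
          refine ⟨x * y, m + k, mul_mem hx hy, ?_⟩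
          rw [pow_add, map_mul, map_mul, ← hm, ← hk]
          ac_rfl }
    have hqmem : ∀ c, c ∈ q.compl ↔ ∃ x m, x ∈ p.compl ∧ c * φ (f ^ m) = φ x := fun c => not_not
    refine ⟨q, (hqmem b).mpr ⟨a, n, ha, e⟩, ?_⟩
    ext x
    refine not_iff_not.mp (Iff.trans (hqmem (φ x)) ?_)
    constructor
    · rintro ⟨y, m, hy, hm⟩
      rw [← map_mul] at hm
      exact Prime.compl_of_mul_right (key _ _ hm.symm hy)
    · intro hx
      exact ⟨x, 0, hx, by simp⟩

theorem range_comap (H : Submonoid.IsLocalizationMap (Submonoid.powers f) φ) :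
    Set.range (Prime.comap φ) = Prime.basic f := by
  have := image_basic H (a := 1) (b := 1) (n := 0) (by simp)
  rwa [Prime.basic_one, Set.image_univ, one_mul] at this

theorem isOpenEmbedding_comap (H : Submonoid.IsLocalizationMap (Submonoid.powers f) φ) :
    Topology.IsOpenEmbedding (Prime.comap φ) := by
  refine .of_continuous_injective_isOpenMap (Prime.continuous_comap φ) (comap_injective H) ?_
  rw [Prime.isBasis_basic.isOpenMap_iff]
  rintro _ ⟨b, rfl⟩
  obtain ⟨a, n, e⟩ := exists_mul_eq H b
  rw [image_basic H e]
  exact Prime.isOpen_basic _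

theorem locMap_injective (H : Submonoid.IsLocalizationMap (Submonoid.powers f) φ) (q : Prime B) :
    Function.Injective (locMap φ q) := by
  intro x y
  induction x using Localization.induction_on with | _ x
  induction y using Localization.induction_on with | _ y
  obtain ⟨a, s⟩ := x
  obtain ⟨b, t⟩ := y
  intro h
  rw [locMap_mk, locMap_mk] at h
  obtain ⟨c, hc, e⟩ := mk_eq_iff.mp h
  obtain ⟨d, n, hd⟩ := exists_mul_eq H c
  have h1 : φ (d * (t * a)) = φ (d * (s * b)) := by
    simp only [map_mul, ← hd] at e ⊢
    rw [mul_right_comm, e, mul_right_comm]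
  obtain ⟨⟨_, k, rfl⟩, hk⟩ := H.exists_of_eq h1
  refine mk_eq_iff.mpr ⟨f ^ k * d, ?_, ?_⟩
  · rw [Prime.mem_comap_compl, map_mul, ← hd]
    exact mul_mem (map_pow_mem_compl H k q) (mul_mem hc (map_pow_mem_compl H n q))
  · simpa only [mul_assoc] using hk

theorem mk_eq_locMap (H : Submonoid.IsLocalizationMap (Submonoid.powers f) φ) (q : Prime B)
    {b t : B} (ht : t ∈ q.compl) {a s : A} {n m : ℕ} (ha : b * φ (f ^ n) = φ a)
    (hs : t * φ (f ^ m) = φ s) :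
    ∃ hs' : s * f ^ n ∈ (Prime.comap φ q).compl,
      locMap φ q (Localization.mk (a * f ^ m) ⟨s * f ^ n, hs'⟩) = Localization.mk b ⟨t, ht⟩ := by
  have hs' : s * f ^ n ∈ (Prime.comap φ q).compl := by
    rw [Prime.mem_comap_compl, map_mul, ← hs]
    exact mul_mem (mul_mem ht (map_pow_mem_compl H m q)) (map_pow_mem_compl H n q)
  refine ⟨hs', ?_⟩
  rw [locMap_mk, mk_eq_iff]
  refine ⟨1, one_mem _, ?_⟩
  simp only [map_mul, ← ha, ← hs]
  ac_rfl

theorem locMap_surjective (H : Submonoid.IsLocalizationMap (Submonoid.powers f) φ) (q : Prime B) :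
    Function.Surjective (locMap φ q) := by
  intro x
  induction x using Localization.induction_on with | _ x
  obtain ⟨b, t⟩ := x
  obtain ⟨a, n, ha⟩ := exists_mul_eq H b
  obtain ⟨s, m, hs⟩ := exists_mul_eq H t
  exact ⟨_, (mk_eq_locMap H q t.2 ha hs).2⟩

theorem sectionsComap_bijective (H : Submonoid.IsLocalizationMap (Submonoid.powers f) φ)
    {U : Opens (specTop B)} {W : Opens (specTop A)}
    (hW : (W : Set (Prime A)) = Prime.comap φ '' (U : Set (specTop B))) :
    Function.Bijective (sectionsComap φ W) := by
  have hmem : ∀ p : W, ∃ q ∈ U, Prime.comap φ q = p.1 := fun p => by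
    have h : p.1 ∈ (W : Set (Prime A)) := p.2
    rw [hW] at h
    exact h
  constructor
  · intro s t h
    refine Subtype.ext <| funext fun p => ?_
    obtain ⟨p, hp⟩ := p
    obtain ⟨q, hq, rfl⟩ := hmem ⟨p, hp⟩
    exact locMap_injective H q (congr_fun (congrArg Subtype.val h) ⟨q, hp⟩)
  · intro t
    have : ∀ p : W, ∃ y : Loc (A := A) p.1, ∀ (q : Prime B) (h : p.1 = Prime.comap φ q),
        locMap φ q (h ▸ y) = t.1 ⟨q, (show Prime.comap φ q ∈ W from h ▸ p.2)⟩ := by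
      rintro ⟨p, hp⟩
      obtain ⟨q, hq, rfl⟩ := hmem ⟨p, hp⟩
      obtain ⟨y, hy⟩ := locMap_surjective H q (t.1 ⟨q, hp⟩)
      refine ⟨y, fun q' h => ?_⟩
      obtain rfl := comap_injective H h
      exact hy
    choose y hy using this
    refine ⟨⟨y, ?_⟩, ?_⟩
    · rintro ⟨p, hp⟩
      obtain ⟨q, hq, rfl⟩ := hmem ⟨p, hp⟩
      obtain ⟨V, hV, i, b, c, h⟩ := t.2 ⟨q, hp⟩
      obtain ⟨a, n, ha⟩ := exists_mul_eq H b
      obtain ⟨s, m, hs⟩ := exists_mul_eq H c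
      refine ⟨⟨Prime.comap φ '' (V : Set (specTop B)), (isOpenEmbedding_comap H).isOpenMap _ V.2⟩,
        ⟨q, hV, rfl⟩, homOfLE ?_, a * f ^ m, s * f ^ n, ?_⟩
      · rintro _ ⟨r, hr, rfl⟩
        exact i.le hr
      · rintro ⟨_, ⟨r, hr, rfl⟩⟩
        obtain ⟨hc, hr'⟩ := h ⟨r, hr⟩
        obtain ⟨h1, h2⟩ := mk_eq_locMap H r hc ha hs
        refine ⟨h1, locMap_injective H r ?_⟩
        rw [h2]
        exact (hy ⟨Prime.comap φ r, i.le hr⟩ r rfl).trans hr'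
    · refine Subtype.ext <| funext fun q => ?_
      exact hy ⟨Prime.comap φ q.1, q.2⟩ q.1 rfl

theorem specMap_isOpenImmersion (H : Submonoid.IsLocalizationMap (Submonoid.powers f) φ) :
    AlgebraicGeometry.SheafedSpace.IsOpenImmersion (specMap φ) where
  base_open := isOpenEmbedding_comap H
  c_iso := fun (U : Opens (specTop B)) => by
    let W : Opens (specTop A) :=
      ⟨Prime.comap φ '' (U : Set (specTop B)), (isOpenEmbedding_comap H).isOpenMap _ U.2⟩
    have hb := sectionsComap_bijective H (U := U) (W := W) rfl
    exact (MulEquiv.toCommMonCatIso (MulEquiv.ofBijective _ hb)).isIso_hom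

end Localization

/-! ## Monoid rings -/

section MonoidRing

/-- The functor `A ↦ A ⊗ ℤ = ℤ[A]` from commutative monoids to commutative rings. -/
def monoidRing : CommMonCat.{u} ⥤ CommRingCat.{u} where
  obj A := CommRingCat.of (MonoidAlgebra ℤ A)
  map φ := CommRingCat.ofHom (MonoidAlgebra.mapDomainRingHom ℤ φ.hom)
  map_id A := by
    ext : 1
    apply MonoidAlgebra.ringHom_ext <;> intro <;> simp
  map_comp φ ψ := by
    ext : 1
    apply MonoidAlgebra.ringHom_ext <;> intro <;> simp

variable {M N : Type u} [CommMonoid M] [CommMonoid N]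

theorem mapDomain_isLocalization {φ : M →* N} {f : M}
    (H : Submonoid.IsLocalizationMap (Submonoid.powers f) φ) :
    letI := (MonoidAlgebra.mapDomainRingHom ℤ φ).toAlgebra
    IsLocalization.Away (MonoidAlgebra.single f (1 : ℤ)) (MonoidAlgebra ℤ N) := by
  let _ := (MonoidAlgebra.mapDomainRingHom ℤ φ).toAlgebra
  have halg : ∀ x, algebraMap (MonoidAlgebra ℤ M) (MonoidAlgebra ℤ N) x =
    MonoidAlgebra.mapDomainRingHom ℤ φ x := fun x => rfl
  have hpow : ∀ n : ℕ, (MonoidAlgebra.single f (1 : ℤ)) ^ n = MonoidAlgebra.single (f ^ n) 1 :=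
    fun n => by rw [MonoidAlgebra.single_pow, one_pow]
  refine (isLocalization_iff _ _).mpr ⟨?_, ?_, ?_⟩
  · rintro ⟨_, n, rfl⟩
    obtain ⟨c, hc⟩ := isUnit_iff_exists_inv.mp (H.map_units ⟨_, n, rfl⟩)
    refine isUnit_iff_exists_inv.mpr ⟨MonoidAlgebra.single c 1, ?_⟩
    dsimp only at hc ⊢
    rw [hpow, halg, MonoidAlgebra.mapDomainRingHom_apply, MonoidAlgebra.mapDomain_single,
      MonoidAlgebra.single_mul_single, hc, one_mul]
    rfl
  · intro z
    suffices h : ∃ (x : MonoidAlgebra ℤ M) (n : ℕ),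
        z * MonoidAlgebra.single (φ (f ^ n)) (1 : ℤ) = MonoidAlgebra.mapDomainRingHom ℤ φ x by
      obtain ⟨x, n, h⟩ := h
      refine ⟨⟨x, ⟨_, n, rfl⟩⟩, ?_⟩
      dsimp only
      rw [hpow, halg, halg, MonoidAlgebra.mapDomainRingHom_apply ℤ φ (MonoidAlgebra.single _ _), MonoidAlgebra.mapDomain_single]
      exact h
    induction z using MonoidAlgebra.induction_linear with
    | zero => exact ⟨0, 0, by simp⟩
    | add z w hz hw =>
      obtain ⟨x, n, hx⟩ := hz
      obtain ⟨y, m, hy⟩ := hw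
      refine ⟨x * MonoidAlgebra.single (f ^ m) 1 + y * MonoidAlgebra.single (f ^ n) 1, n + m, ?_⟩
      rw [map_add, map_mul, map_mul, ← hx, ← hy]
      simp only [MonoidAlgebra.mapDomainRingHom_apply, MonoidAlgebra.mapDomain_single, mul_assoc,
        MonoidAlgebra.single_mul_single, ← map_mul, ← pow_add, one_mul, add_mul, add_comm m n]
    | single b k =>
      obtain ⟨⟨a, _, n, rfl⟩, h⟩ := H.surj b
      refine ⟨MonoidAlgebra.single a k, n, ?_⟩
      simp only [MonoidAlgebra.mapDomainRingHom_apply, MonoidAlgebra.mapDomain_single,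
        MonoidAlgebra.single_mul_single, mul_one]
      exact congrArg (MonoidAlgebra.single · k) h
  · intro x y hxy
    classical
    have huni : ∀ s : Finset (M × M), (∀ p ∈ s, φ p.1 = φ p.2) →
        ∃ n : ℕ, ∀ p ∈ s, f ^ n * p.1 = f ^ n * p.2 := by
      intro s
      induction s using Finset.induction_on with
      | empty => intro _; exact ⟨0, by simp⟩
      | insert p s _ ih =>
        intro h
        obtain ⟨n, hn⟩ := ih fun q hq => h q (Finset.mem_insert_of_mem hq)
        obtain ⟨⟨_, m, rfl⟩, hm⟩ := H.exists_of_eq (h p (Finset.mem_insert_self _ _))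
        change f ^ m * p.1 = f ^ m * p.2 at hm
        refine ⟨n + m, fun q hq => ?_⟩
        rcases Finset.mem_insert.mp hq with rfl | hq
        · rw [pow_add, mul_assoc, hm, mul_assoc]
        · rw [add_comm, pow_add, mul_assoc, hn q hq, mul_assoc]
    let S : Finset M := x.coeff.support ∪ y.coeff.support
    obtain ⟨n, hn⟩ := huni ((S ×ˢ S).filter fun p => φ p.1 = φ p.2)
      fun p hp => (Finset.mem_filter.mp hp).2
    let g : N → M := fun b => if h : ∃ a ∈ S, φ a = b then f ^ n * h.choose else 1
    have hg : ∀ a ∈ S, g (φ a) = f ^ n * a := by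
      intro a ha
      have h : ∃ a' ∈ S, φ a' = φ a := ⟨a, ha, rfl⟩
      refine (dif_pos h).trans (hn ⟨h.choose, a⟩ ?_)
      exact Finset.mem_filter.mpr
        ⟨Finset.mem_product.mpr ⟨h.choose_spec.1, ha⟩, h.choose_spec.2⟩
    have hmul : ∀ z : MonoidAlgebra ℤ M, MonoidAlgebra.single (f ^ n) (1 : ℤ) * z =
        MonoidAlgebra.mapDomain (f ^ n * ·) z := by
      intro z
      induction z using MonoidAlgebra.induction_linear with
      | zero => simp
      | add z w hz hw => rw [mul_add, hz, hw, MonoidAlgebra.mapDomain_add]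
      | single b k => simp [MonoidAlgebra.single_mul_single, MonoidAlgebra.mapDomain_single]
    have hz : ∀ z : MonoidAlgebra ℤ M, z.coeff.support ⊆ S →
        MonoidAlgebra.single (f ^ n) (1 : ℤ) * z =
          MonoidAlgebra.mapDomain g (MonoidAlgebra.mapDomainRingHom ℤ φ z) := by
      intro z hzS
      rw [hmul, MonoidAlgebra.mapDomainRingHom_apply]
      refine congrArg MonoidAlgebra.ofCoeff ?_
      rw [MonoidAlgebra.coeff_mapDomain, ← Finsupp.mapDomain_comp]
      exact Finsupp.mapDomain_congr fun a ha => (hg a (hzS ha)).symm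
    refine ⟨⟨_, n, rfl⟩, ?_⟩
    dsimp only
    rw [hpow, hz x Finset.subset_union_left, hz y Finset.subset_union_right]
    exact congrArg _ hxy

end MonoidRing

/-! ## Monoid schemes -/

open AlgebraicGeometry (Scheme Spec)

/-- A subset of a monoidal space is an affine open if it is the image of an open immersion of the
spectrum of a monoid. -/
def IsAffineOpen (X : MonoidalSpace.{u}) (U : Set X) : Prop :=
  ∃ (A : CommMonCat.{u}) (j : spec A ⟶ X),
    AlgebraicGeometry.SheafedSpace.IsOpenImmersion j ∧ Set.range j.hom.base = U

/-- A scheme over `𝔽₁` (monoid scheme): a topological space with a sheaf of commutative monoids,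
locally isomorphic to spectra of commutative monoids. -/
structure MonoidScheme where
  /-- the underlying space with its structure sheaf -/
  toSpace : MonoidalSpace.{u}
  exists_affine : ∀ x : toSpace, ∃ U : Set toSpace, IsAffineOpen toSpace U ∧ x ∈ U

section Charts

variable {X : MonoidalSpace.{u}}

theorem exists_chart {A : CommMonCat.{u}} (j : spec A ⟶ X)
    [hj : AlgebraicGeometry.SheafedSpace.IsOpenImmersion j]
    (U : Opens X) (hU : (U : Set X) = Set.range j.hom.base) :
    ∃ e : A →* X.presheaf.obj (op U), ∀ (a : A) (V : Opens X) (h : V ≤ U),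
      (V : Set X) = j.hom.base '' Prime.basic a →
        Submonoid.IsLocalizationMap (Submonoid.powers (e a))
          (X.presheaf.map (homOfLE h).op).hom := by
  obtain rfl : U = hj.base_open.functor.obj ⊤ := Opens.ext (by rw [hU]; exact Set.image_univ.symm)
  have hbij : ∀ W : Opens (spec A), Function.Bijective
      (AlgebraicGeometry.PresheafedSpace.IsOpenImmersion.invApp j.hom W).hom := fun W =>
    ConcreteCategory.bijective_of_isIso
      (AlgebraicGeometry.PresheafedSpace.IsOpenImmersion.invApp j.hom W)
  refine ⟨(AlgebraicGeometry.PresheafedSpace.IsOpenImmersion.invApp j.hom ⊤).hom.comp (toSec ⊤), ?_⟩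
  intro a V h hV
  obtain rfl : V = hj.base_open.functor.obj (basicOpen a) := Opens.ext hV
  refine isLocalizationMap_transport (hbij ⊤) (hbij (basicOpen a)) (fun x => ?_) _
    (sectionsRes_isLocalizationMap a)
  exact congr($(AlgebraicGeometry.PresheafedSpace.IsOpenImmersion.inv_naturality j.hom
    (homOfLE (le_top : basicOpen a ≤ ⊤)).op).hom x)

theorem isAffineOpen_basic {A : CommMonCat.{u}} (j : spec A ⟶ X)
    [hj : AlgebraicGeometry.SheafedSpace.IsOpenImmersion j] (a : A) :
    IsAffineOpen X (j.hom.base '' Prime.basic a) := by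
  have H : Submonoid.IsLocalizationMap (Submonoid.powers a)
      (Localization.monoidOf (Submonoid.powers a)).toMonoidHom :=
    (Localization.monoidOf (Submonoid.powers a)).isLocalizationMap
  have := specMap_isOpenImmersion H
  refine ⟨CommMonCat.of (Localization (Submonoid.powers a)),
    specMap (Localization.monoidOf (Submonoid.powers a)).toMonoidHom ≫ j,
    AlgebraicGeometry.SheafedSpace.IsOpenImmersion.comp _ _, ?_⟩
  exact (Set.range_comp j.hom.base _).trans (congrArg (j.hom.base '' ·) (range_comap H))

theorem image_basic_mul {A : CommMonCat.{u}} (j : spec A ⟶ X)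
    [hj : AlgebraicGeometry.SheafedSpace.IsOpenImmersion j] (a b : A) :
    j.hom.base '' Prime.basic (a * b) = j.hom.base '' Prime.basic a ∩ j.hom.base '' Prime.basic b :=
  (congrArg (j.hom.base '' ·) (Prime.basic_mul a b)).trans
    (Set.image_inter hj.base_open.injective)

theorem exists_eq_basic {A : CommMonCat.{u}} (j : spec A ⟶ X)
    [hj : AlgebraicGeometry.SheafedSpace.IsOpenImmersion j] {V : Set X}
    (hV : IsAffineOpen X V) (h : V ⊆ Set.range j.hom.base) :
    ∃ a : A, V = j.hom.base '' Prime.basic a := by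
  obtain ⟨B, i, hi, rfl⟩ := hV
  obtain ⟨p, hp⟩ := h ⟨Prime.away 1, rfl⟩
  have hopen : IsOpen (j.hom.base ⁻¹' Set.range i.hom.base) :=
    hi.base_open.isOpen_range.preimage hj.base_open.continuous
  obtain ⟨_, ⟨a, rfl⟩, hpa, ha⟩ := Prime.isBasis_basic.exists_subset_of_mem_open
    (show p ∈ j.hom.base ⁻¹' Set.range i.hom.base from ⟨_, hp.symm⟩) hopen
  refine ⟨a, Set.Subset.antisymm ?_ (Set.image_subset_iff.mpr ha)⟩
  have hopen' : IsOpen (i.hom.base ⁻¹' (j.hom.base '' Prime.basic a)) :=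
    (hj.base_open.isOpenMap _ (Prime.isOpen_basic a)).preimage hi.base_open.continuous
  have := Prime.basic_subset hopen' (f := 1) ⟨p, hpa, hp⟩
  rw [Prime.basic_one] at this
  rintro _ ⟨q, rfl⟩
  exact this (Set.mem_univ q)

end Charts

section SpecMap

variable {M N : CommMonCat.{u}} {φ : M ⟶ N} {f : M}

theorem specMap_monoidRing (H : Submonoid.IsLocalizationMap (Submonoid.powers f) φ.hom) :
    AlgebraicGeometry.IsOpenImmersion (Spec.map (monoidRing.map φ)) ∧
      Set.range (Spec.map (monoidRing.map φ)) =
        (PrimeSpectrum.basicOpen (MonoidAlgebra.single f (1 : ℤ)) :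
          Set (PrimeSpectrum (MonoidAlgebra ℤ M))) := by
  let _ := (MonoidAlgebra.mapDomainRingHom ℤ φ.hom).toAlgebra
  have := mapDomain_isLocalization H
  exact ⟨AlgebraicGeometry.IsOpenImmersion.of_isLocalization
    (R := MonoidAlgebra ℤ M) (S := MonoidAlgebra ℤ N) (MonoidAlgebra.single f (1 : ℤ)),
    PrimeSpectrum.localization_away_comap_range (MonoidAlgebra ℤ N)
      (MonoidAlgebra.single f (1 : ℤ))⟩

end SpecMap

namespace MonoidScheme

variable (X : MonoidScheme.{u})

/-- The affine open subsets of a monoid scheme, ordered by inclusion. -/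
abbrev AffineOpens : Type u := {U : Opens X.toSpace // IsAffineOpen X.toSpace (U : Set X.toSpace)}

/-- The diagram of the affine schemes `Spec ℤ[𝒪(U)]`, where `U` runs through all affine open subsets
of `X`. -/
def affineDiagram : X.AffineOpens ⥤ Scheme.{u} where
  obj U := Spec (monoidRing.obj (X.toSpace.presheaf.obj (op U.1)))
  map i := Spec.map (monoidRing.map (X.toSpace.presheaf.map (homOfLE (leOfHom i)).op))
  map_id U := by
    rw [← Spec.map_id, ← monoidRing.map_id, ← X.toSpace.presheaf.map_id]
    rfl
  map_comp i j := by
    rw [← Spec.map_comp, ← monoidRing.map_comp, ← X.toSpace.presheaf.map_comp]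
    rfl

instance {U V : X.AffineOpens} (i : V ⟶ U) :
    AlgebraicGeometry.IsOpenImmersion (X.affineDiagram.map i) := by
  obtain ⟨A, j, hj, hU⟩ := U.2
  obtain ⟨e, he⟩ := exists_chart j U.1 hU.symm
  obtain ⟨a, ha⟩ := exists_eq_basic j V.2 (by rw [hU]; exact leOfHom i)
  exact (specMap_monoidRing (he a V.1 (leOfHom i) ha)).1

theorem mem_range_map {U V : X.AffineOpens} (i : V ⟶ U) {a : X.toSpace.presheaf.obj (op U.1)}
    (ha : Submonoid.IsLocalizationMap (Submonoid.powers a)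
      (X.toSpace.presheaf.map (homOfLE (show V.1 ≤ U.1 from leOfHom i)).op).hom) (z : X.affineDiagram.obj U) :
    (∃ x, X.affineDiagram.map i x = z) ↔
      MonoidAlgebra.single a (1 : ℤ) ∉ PrimeSpectrum.asIdeal z :=
  Set.ext_iff.mp (specMap_monoidRing ha).2 z

theorem exists_map_eq {V W U : X.AffineOpens} (i : V ⟶ U) (j : W ⟶ U) (x : X.affineDiagram.obj V)
    (y : X.affineDiagram.obj W) (hxy : X.affineDiagram.map i x = X.affineDiagram.map j y) :
    ∃ (L : X.AffineOpens) (l : L ⟶ V) (m : L ⟶ W) (z : X.affineDiagram.obj L),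
      X.affineDiagram.map l z = x ∧ X.affineDiagram.map m z = y := by
  obtain ⟨A, k, hk, hU⟩ := U.2
  obtain ⟨e, he⟩ := exists_chart k U.1 hU.symm
  obtain ⟨a, ha⟩ := exists_eq_basic k V.2 (by rw [hU]; exact leOfHom i)
  obtain ⟨b, hb⟩ := exists_eq_basic k W.2 (by rw [hU]; exact leOfHom j)
  have hab : ((V.1 ⊓ W.1 : Opens X.toSpace) : Set X.toSpace) =
      k.hom.base '' Prime.basic (a * b) := by
    rw [image_basic_mul, ← ha, ← hb]
    rfl
  let L : X.AffineOpens := ⟨V.1 ⊓ W.1, by rw [hab]; exact isAffineOpen_basic k (a * b)⟩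
  let l : L ⟶ V := homOfLE (show V.1 ⊓ W.1 ≤ V.1 from inf_le_left)
  let m : L ⟶ W := homOfLE (show V.1 ⊓ W.1 ≤ W.1 from inf_le_right)
  have h1 := (X.mem_range_map i (he a V.1 (leOfHom i) ha) _).mp ⟨x, rfl⟩
  have h2 := (X.mem_range_map j (he b W.1 (leOfHom j) hb) _).mp ⟨y, rfl⟩
  rw [← hxy] at h2
  obtain ⟨z, hz⟩ := (X.mem_range_map (l ≫ i) (he (a * b) L.1 (leOfHom (l ≫ i)) hab)
    (X.affineDiagram.map i x)).mpr (by
      have h3 : MonoidAlgebra.single (e (a * b)) (1 : ℤ) =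
          MonoidAlgebra.single (e a) 1 * MonoidAlgebra.single (e b) 1 := by
        rw [MonoidAlgebra.single_mul_single, map_mul, one_mul]
      rw [h3]
      exact fun h => ((PrimeSpectrum.isPrime _).mem_or_mem h).elim h1 h2)
  refine ⟨L, l, m, z, ?_, ?_⟩
  · refine (X.affineDiagram.map i).isOpenEmbedding.injective ?_
    rw [Functor.map_comp, AlgebraicGeometry.Scheme.Hom.comp_apply] at hz
    exact hz
  · refine (X.affineDiagram.map j).isOpenEmbedding.injective ?_
    have hlm : l ≫ i = m ≫ j := Subsingleton.elim _ _
    rw [hlm, Functor.map_comp, AlgebraicGeometry.Scheme.Hom.comp_apply, hxy] at hz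
    exact hz

instance : (X.affineDiagram ⋙ Scheme.forget).IsLocallyDirected where
  cond i j x y hxy := X.exists_map_eq i j x y hxy

instance : Limits.HasColimit X.affineDiagram := inferInstance

/-- The scheme `X_ℤ` obtained from the monoid scheme `X` by ascent: the affine schemes
`Spec ℤ[𝒪(U)]`, for the affine open subsets `U` of `X`, are glued along the open immersions
`Spec ℤ[𝒪(V)] ⟶ Spec ℤ[𝒪(U)]` for `V ⊆ U`. -/
def ascent : Scheme.{u} := Limits.colimit X.affineDiagram

/-- `X` is of finite type: it is covered by finitely many spectra of finitely generated monoids. -/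
def IsFiniteType : Prop :=
  ∃ (n : ℕ) (A : Fin n → CommMonCat.{u}) (j : ∀ i, spec (A i) ⟶ X.toSpace),
    (∀ i, AlgebraicGeometry.SheafedSpace.IsOpenImmersion (j i)) ∧ (∀ i, Monoid.FG (A i)) ∧
      ∀ x : X.toSpace, ∃ i, x ∈ Set.range (j i).hom.base

/-- The stalk `𝒪_{X,x}`: the filtered colimit of the monoids `𝒪(U)`, where `U` runs through the open
neighbourhoods of `x`. -/
def stalk (x : X.toSpace) : CommMonCat.{u} :=
  CommMonCat.FilteredColimits.colimit.{u, u} ((OpenNhds.inclusion x).op ⋙ X.toSpace.presheaf)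

/-- The unit group of the stalk at a point. -/
abbrev stalkUnits (x : X.toSpace) : Type u := (X.stalk x)ˣ

/-- The exponent of `X`: the least common multiple of the exponents of the torsion subgroups of
the groups `𝒪_{X,x}ˣ`. -/
def exponent : ℕ :=
  sInf {n : ℕ | 0 < n ∧ ∀ x, Monoid.exponent (CommGroup.torsion (X.stalkUnits x)) ∣ n}

/-- The rank of `X`: the maximum of the ranks of the groups `𝒪_{X,x}ˣ`. -/
def rank : ℕ := ⨆ x : X.toSpace, Module.finrank ℤ (Additive (X.stalkUnits x))

end MonoidScheme

/-- The polynomial `N` counts the points of the scheme `Y` over all finite fields with `q` elements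
such that `q - 1` is coprime to `e`. -/
def CountsPoints (Y : Scheme.{u}) (e : ℕ) (N : Polynomial ℤ) : Prop :=
  ∀ q : ℕ, IsPrimePow q → Nat.gcd (q - 1) e = 1 →
    ∀ (K : Type u) [Field K], Nat.card K = q →
      (Nat.card (Spec (CommRingCat.of K) ⟶ Y) : ℤ) = N.eval (q : ℤ)

end FOne

end

/-!
A point of `Spec ℤ[A]` with values in a field `K` is a homomorphism `φ` from `A` to the
multiplicative monoid of `K`. The elements with `φ a = 0` form a prime ideal `p`, and `φ` is
determined by `p` together with the character of the unit group of `A_p` that it induces; every such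
pair occurs (`exists_evalHom_eq`, `evalHom_injective`). So over an affine open subset `U` of `X` the
`K`-valued points of `Spec ℤ[𝒪(U)]` are the pairs of a point `x ∈ U` and a character
`𝒪_{X,x}ˣ → Kˣ`. This description is compatible with restriction to smaller affine open sets, and a
morphism from `Spec K` factors through any open immersion that contains its image, so it glues to
`X_ℤ(K) = ∐_x Hom(𝒪_{X,x}ˣ, Kˣ)` (`MonoidScheme.toPoint_bijective`).

If `X` is of finite type, then `X` is finite and the groups `𝒪_{X,x}ˣ` are finitely generated, which
gives finiteness. If `q - 1` is prime to the orders of all torsion elements, then characters with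
values in the group `𝔽_qˣ` of order `q - 1` kill the torsion, so there are `(q - 1) ^ r(x)` of them,
where `r(x)` is the rank (`card_monoidHom`). Hence `N = ∑_x (T - 1) ^ r(x)` counts the points. It is
the only such polynomial, because for every `e > 0` there are infinitely many `n` such that
`2 ^ n - 1` is prime to `e` (`exists_two_pow_coprime`).
-/

noncomputable section

namespace FOne

open CategoryTheory TopologicalSpace Opposite
open AlgebraicGeometry (Scheme Spec)

/-! ### Homomorphisms out of a finitely generated abelian group -/

section Counting

variable {G H : Type*} [CommGroup G] [CommGroup H]

theorem finite_monoidHom [Group.FG G] [Finite H] : Finite (G →* H) := by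
  obtain ⟨S, hS, hfin⟩ := Group.fg_iff.mp (inferInstance : Group.FG G)
  have : Finite S := hfin
  refine Finite.of_injective (fun (φ : G →* H) (s : S) => φ s) fun φ ψ h => ?_
  exact MonoidHom.eq_of_eqOn_dense hS fun s hs => congr_fun h ⟨s, hs⟩

theorem map_torsion_eq_one [Finite H] {e : ℕ}
    (he : Monoid.exponent (CommGroup.torsion G) ∣ e) (hcop : Nat.gcd (Nat.card H) e = 1)
    (φ : G →* H) {g : G} (hg : g ∈ CommGroup.torsion G) : φ g = 1 := by
  have h1 : g ^ e = 1 := by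
    have h := (Monoid.exponent_dvd_iff_forall_pow_eq_one.mp he) ⟨g, hg⟩
    exact congrArg Subtype.val h
  have h2 : φ g ^ e = 1 := by rw [← map_pow, h1, map_one]
  have h3 : φ g ^ Nat.card H = 1 := pow_card_eq_one'
  have := Nat.dvd_gcd (orderOf_dvd_of_pow_eq_one h3) (orderOf_dvd_of_pow_eq_one h2)
  rwa [hcop, Nat.dvd_one, orderOf_eq_one_iff] at this

/-- Under the coprimality condition the homomorphisms factor through the free quotient of `G`
by its torsion subgroup, and are determined freely by the images of a basis. -/
theorem card_monoidHom [Group.FG G] [Finite H] {e : ℕ}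
    (he : Monoid.exponent (CommGroup.torsion G) ∣ e) (hcop : Nat.gcd (Nat.card H) e = 1) :
    Nat.card (G →* H) = Nat.card H ^ Module.finrank ℤ (Additive G) := by
  let T := Submodule.torsion ℤ (Additive G)
  have : Module.Finite ℤ (Additive G) := Module.Finite.iff_addGroup_fg.mpr inferInstance
  have : Module.Free ℤ (Additive G ⧸ T) := Module.free_of_finite_type_torsion_free'
  let b := Module.finBasis ℤ (Additive G ⧸ T)
  have hT : ∀ x ∈ T, x.toMul ∈ CommGroup.torsion G := by
    rintro x ⟨⟨n, hn⟩, hx⟩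
    have hn0 : n ≠ 0 := nonZeroDivisors.ne_zero hn
    have hx' : x.toMul ^ n = 1 := hx
    exact isOfFinOrder_iff_zpow_eq_one.mpr ⟨n, hn0, hx'⟩
  have hbij : Function.Bijective
      (fun f : (Additive G ⧸ T) →ₗ[ℤ] Additive H => f.comp T.mkQ) := by
    constructor
    · intro f g h
      exact Submodule.linearMap_qext _ h
    · intro f
      refine ⟨T.liftQ f fun x hx => ?_, T.liftQ_mkQ f _⟩
      exact map_torsion_eq_one he hcop (MonoidHom.toAdditive.symm f.toAddMonoidHom) (hT x hx)
  rw [Nat.card_congr (MonoidHom.toAdditive (α := G) (β := H)),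
    Nat.card_congr (addMonoidHomLequivInt (A := Additive G) (B := Additive H) ℤ).toEquiv,
    ← Nat.card_congr (Equiv.ofBijective _ hbij),
    ← Nat.card_congr (b.constr (M' := Additive H) ℤ).toEquiv, Nat.card_fun,
    Nat.card_fin, finrank_quotient_eq_of_le_torsion le_rfl]
  rfl

theorem exponent_torsion_pos [Group.FG G] : 0 < Monoid.exponent (CommGroup.torsion G) := by
  have : Module.Finite ℤ (Additive G) := Module.Finite.iff_addGroup_fg.mpr inferInstance
  have : Finite (Submodule.torsion ℤ (Additive G)) :=
    Module.finite_of_fg_torsion _ (Submodule.torsion_isTorsion)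
  have : Finite (CommGroup.torsion G) := by
    refine Finite.of_injective (β := Submodule.torsion ℤ (Additive G))
      (fun g => ⟨Additive.ofMul g.1, ?_⟩) fun g h he => ?_
    · obtain ⟨n, hn, hg⟩ := isOfFinOrder_iff_zpow_eq_one.mp g.2
      exact ⟨⟨n, mem_nonZeroDivisors_of_ne_zero hn⟩, hg⟩
    · have he' := congrArg Subtype.val he
      exact Subtype.ext (Additive.ofMul.injective he')
  exact Nat.pos_of_ne_zero Monoid.exponent_ne_zero_of_finite

end Counting

/-! ### Localisations and homomorphisms to a group with zero -/

section EvalHom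

variable {M N K : Type*} [CommMonoid M] [CommMonoid N] [CommGroupWithZero K]

/-- The submonoid of all elements that become units under `g`. -/
def unitLocus (g : M →* N) : Submonoid M := (IsUnit.submonoid N).comap g

theorem mem_unitLocus {g : M →* N} {a : M} : a ∈ unitLocus g ↔ IsUnit (g a) := Iff.rfl

open Classical in
/-- The homomorphism to `K` that is given by the character `χ` on the elements that become units
under `g`, and vanishes on all other elements. -/
def evalHom (g : M →* N) (χ : Nˣ →* Kˣ) : M →* K where
  toFun a := if h : IsUnit (g a) then χ h.unit else 0
  map_one' := by
    have h : IsUnit (g 1) := by rw [map_one]; exact isUnit_one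
    have h1 : h.unit = 1 := Units.ext (by simp)
    rw [dif_pos h, h1, map_one, Units.val_one]
  map_mul' a b := by
    by_cases ha : IsUnit (g a)
    · by_cases hb : IsUnit (g b)
      · have h : IsUnit (g (a * b)) := by rw [map_mul]; exact ha.mul hb
        have h1 : h.unit = ha.unit * hb.unit := Units.ext (by simp)
        rw [dif_pos h, dif_pos ha, dif_pos hb, h1, map_mul, Units.val_mul]
      · have h : ¬ IsUnit (g (a * b)) := by
          rw [map_mul, IsUnit.mul_iff]
          exact fun h => hb h.2
        rw [dif_neg h, dif_neg hb, mul_zero]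
    · have h : ¬ IsUnit (g (a * b)) := by
        rw [map_mul, IsUnit.mul_iff]
        exact fun h => ha h.1
      rw [dif_neg h, dif_neg ha, zero_mul]

theorem evalHom_of_eq {g : M →* N} {χ : Nˣ →* Kˣ} {a : M} {v : Nˣ} (h : g a = v) :
    evalHom g χ a = χ v := by
  have hu : IsUnit (g a) := h ▸ v.isUnit
  have h1 : hu.unit = v := Units.ext h
  exact (dif_pos hu).trans (by rw [h1])

theorem evalHom_of_not {g : M →* N} {χ : Nˣ →* Kˣ} {a : M} (h : ¬ IsUnit (g a)) :
    evalHom g χ a = 0 := dif_neg h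

theorem evalHom_ne_zero_iff {g : M →* N} {χ : Nˣ →* Kˣ} {a : M} :
    evalHom g χ a ≠ 0 ↔ IsUnit (g a) := by
  refine ⟨fun h => by_contra fun h1 => h (evalHom_of_not h1), fun ⟨v, hv⟩ => ?_⟩
  rw [evalHom_of_eq hv.symm]
  exact Units.ne_zero _

theorem evalHom_comp {M' : Type*} [CommMonoid M'] (g : M →* N) (f : M' →* M) (χ : Nˣ →* Kˣ) :
    (evalHom g χ).comp f = evalHom (g.comp f) χ := rfl

theorem evalHom_injective {g : M →* N} (H : Submonoid.IsLocalizationMap (unitLocus g) g) :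
    Function.Injective (evalHom (K := K) g) := by
  intro χ ψ h
  ext v
  obtain ⟨⟨a, s, hs⟩, e⟩ := H.surj v
  obtain ⟨w, hw⟩ := mem_unitLocus.mp hs
  have ha : g a = (v * w : Nˣ) := by rw [← e, Units.val_mul, hw]
  have h1 := DFunLike.congr_fun h a
  have h2 := DFunLike.congr_fun h s
  rw [evalHom_of_eq ha, evalHom_of_eq ha, map_mul, map_mul, Units.val_mul, Units.val_mul] at h1
  rw [evalHom_of_eq hw.symm, evalHom_of_eq hw.symm] at h2
  rw [h2] at h1
  exact mul_right_cancel₀ (Units.ne_zero _) h1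

theorem exists_evalHom_eq {g : M →* N} (H : Submonoid.IsLocalizationMap (unitLocus g) g)
    (φ : M →* K) (hφ : ∀ a, φ a ≠ 0 ↔ IsUnit (g a)) : ∃ χ, evalHom g χ = φ := by
  let L : Submonoid.LocalizationMap (unitLocus g) N := ⟨g.toMulHom, H⟩
  have hu : ∀ y : unitLocus g, IsUnit (φ y) := fun y => ((hφ y).mpr y.2).isUnit
  have hlift : ∀ a, L.lift hu (g a) = φ a := fun a => L.lift_eq hu a
  refine ⟨Units.map (L.lift hu), MonoidHom.ext fun a => ?_⟩
  by_cases h : IsUnit (g a)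
  · obtain ⟨v, hv⟩ := h
    rw [evalHom_of_eq hv.symm, Units.coe_map, hv]
    exact hlift a
  · rw [evalHom_of_not h]
    exact (not_not.mp (mt (hφ a).mp h)).symm

/-- The unit group of a localisation of a finitely generated monoid is generated by the images
of those generators that become units. -/
theorem fg_units [Monoid.FG M] {g : M →* N} (H : Submonoid.IsLocalizationMap (unitLocus g) g) :
    Group.FG Nˣ := by
  obtain ⟨T, hT, hfin⟩ := Monoid.fg_iff.mp (inferInstance : Monoid.FG M)
  let S : Set Nˣ := Units.val ⁻¹' (g '' T)
  refine Group.fg_iff.mpr ⟨S, ?_, (hfin.image g).preimage Units.val_injective.injOn⟩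
  have key : ∀ m, ∀ v : Nˣ, (v : N) = g m → v ∈ Subgroup.closure S := by
    intro m
    have hm : m ∈ Submonoid.closure T := by rw [hT]; trivial
    induction hm using Submonoid.closure_induction with
    | mem x hx => exact fun v hv => Subgroup.subset_closure ⟨x, hx, hv.symm⟩
    | one =>
      intro v hv
      have : v = 1 := Units.ext (by rw [hv, map_one, Units.val_one])
      rw [this]
      exact one_mem _
    | mul x y _ _ hx hy =>
      intro v hv
      have h : IsUnit (g x * g y) := by rw [← map_mul, ← hv]; exact v.isUnit
      obtain ⟨⟨a, ha⟩, ⟨b, hb⟩⟩ := IsUnit.mul_iff.mp h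
      have : v = a * b := Units.ext (by rw [hv, map_mul, Units.val_mul, ha, hb])
      rw [this]
      exact mul_mem (hx a ha) (hy b hb)
  refine eq_top_iff.mpr fun v _ => ?_
  obtain ⟨⟨a, s, hs⟩, e⟩ := H.surj v
  obtain ⟨w, hw⟩ := mem_unitLocus.mp hs
  have ha : ((v * w : Nˣ) : N) = g a := by rw [← e, Units.val_mul, hw]
  exact (mul_mem_cancel_right (key s w hw)).mp (key a _ ha)

end EvalHom

/-! ### Prime ideals and finite generation -/

section Spectrum

variable {A : Type u} [CommMonoid A]

/-- A prime ideal is determined by the generators of the monoid that it contains. -/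
theorem finite_prime [Monoid.FG A] : Finite (Prime A) := by
  obtain ⟨T, hT, hfin⟩ := Monoid.fg_iff.mp (inferInstance : Monoid.FG A)
  have : Finite (Set T) := have : Finite T := hfin; inferInstance
  have key : ∀ p q : Prime A, (∀ t ∈ T, t ∈ p.compl → t ∈ q.compl) → p.compl ≤ q.compl := by
    intro p q h a
    have ha : a ∈ Submonoid.closure T := by rw [hT]; trivial
    induction ha using Submonoid.closure_induction with
    | mem x hx => exact h x hx
    | one => exact fun _ => one_mem _
    | mul x y _ _ hx hy =>
      intro hxy
      exact mul_mem (hx (Prime.compl_of_mul_right hxy)) (hy (Prime.compl_of_mul_left hxy))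
  refine Finite.of_injective (fun p : Prime A => {t : T | (t : A) ∈ p.compl}) fun p q h => ?_
  have h' : ∀ t (ht : t ∈ T), t ∈ p.compl ↔ t ∈ q.compl := fun t ht =>
    Set.ext_iff.mp h ⟨t, ht⟩
  ext a
  exact not_iff_not.mp ⟨fun ha => key p q (fun t ht => (h' t ht).mp) ha,
    fun ha => key q p (fun t ht => (h' t ht).mpr) ha⟩

/-- The elements on which a homomorphism to a group with zero vanishes form a prime ideal. -/
def zeroLocus {K : Type*} [CommGroupWithZero K] (φ : A →* K) : Prime A where
  carrier := {a | φ a = 0}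
  mul_mem a x hx := by rw [Set.mem_ofPred_eq] at hx ⊢; rw [map_mul, hx, mul_zero]
  one_notMem h := by rw [Set.mem_ofPred_eq, map_one] at h; exact one_ne_zero h
  mul_notMem a b ha hb h := by
    rw [Set.mem_ofPred_eq, map_mul] at h
    exact (mul_eq_zero.mp h).elim ha hb

end Spectrum

/-! ### Prime powers -/

/-- For `n ≡ 1` modulo the order of `2` in `(ℤ/k)ˣ`, where `k` is the odd part of `e`, the number
`2 ^ n - 1` is prime to `e`. -/
theorem exists_two_pow_coprime {e : ℕ} (he : 0 < e) (b : ℕ) :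
    ∃ n, b ≤ n ∧ n ≠ 0 ∧ Nat.gcd (2 ^ n - 1) e = 1 := by
  obtain ⟨k, m, hm, rfl⟩ := Nat.exists_eq_two_pow_mul_odd he.ne'
  refine ⟨Nat.totient m * b + 1, ?_, Nat.succ_ne_zero _, ?_⟩
  · have : 0 < Nat.totient m := Nat.totient_pos.mpr hm.pos
    nlinarith
  have h1 : Nat.Coprime (2 ^ (Nat.totient m * b + 1) - 1) 2 := by
    refine Nat.Coprime.symm (Nat.coprime_two_left.mpr ?_)
    refine Nat.Even.sub_odd Nat.one_le_two_pow ?_ odd_one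
    exact (Nat.even_pow.mpr ⟨even_two, Nat.succ_ne_zero _⟩)
  have h2 : 2 ^ (Nat.totient m * b + 1) ≡ 2 [MOD m] := by
    have := ((Nat.ModEq.pow_totient (Nat.coprime_two_left.mpr hm)).pow b).mul_right 2
    rwa [one_pow, one_mul, ← pow_mul, ← pow_succ] at this
  have h3 : Nat.Coprime (2 ^ (Nat.totient m * b + 1) - 1) m := by
    have : 2 ^ (Nat.totient m * b + 1) - 1 ≡ 1 [MOD m] :=
      Nat.ModEq.add_right_cancel' 1 (by rwa [Nat.sub_add_cancel Nat.one_le_two_pow])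
    exact (Nat.ModEq.gcd_eq this).trans (Nat.gcd_one_left m)
  exact (h1.pow_right k).mul_right h3

/-! ### Stalks of a monoid scheme -/

namespace MonoidScheme

variable (X : MonoidScheme.{u})

/-- The germ at `x` of the sections over an open neighbourhood `U` of `x`. -/
def germ (U : Opens X.toSpace) (x : X.toSpace) (hx : x ∈ U) :
    X.toSpace.presheaf.obj (op U) →* X.stalk x :=
  ((CommMonCat.FilteredColimits.colimitCocone.{u, u}
    ((OpenNhds.inclusion x).op ⋙ X.toSpace.presheaf)).ι.app (op ⟨U, hx⟩)).hom

/-- Restriction of sections from `U` to a smaller open set `V`. -/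
abbrev res {U V : Opens X.toSpace} (h : V ≤ U) :
    X.toSpace.presheaf.obj (op U) →* X.toSpace.presheaf.obj (op V) :=
  (X.toSpace.presheaf.map (homOfLE h).op).hom

theorem germ_comp_res {U V : Opens X.toSpace} (h : V ≤ U) {x : X.toSpace} (hx : x ∈ V) :
    (X.germ V x hx).comp (X.res h) = X.germ U x (h hx) := by
  have := (CommMonCat.FilteredColimits.colimitCocone.{u, u}
    ((OpenNhds.inclusion x).op ⋙ X.toSpace.presheaf)).w
      (j' := op ⟨U, h hx⟩) (j := op ⟨V, hx⟩)
      (Quiver.Hom.op (homOfLE (show (⟨V, hx⟩ : OpenNhds x) ≤ ⟨U, h hx⟩ from h)))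
  exact congrArg CommMonCat.Hom.hom this

theorem germ_res {U V : Opens X.toSpace} (h : V ≤ U) {x : X.toSpace} (hx : x ∈ V)
    (a : X.toSpace.presheaf.obj (op U)) : X.germ V x hx (X.res h a) = X.germ U x (h hx) a :=
  DFunLike.congr_fun (X.germ_comp_res h hx) a

theorem res_res {U V W : Opens X.toSpace} (h : V ≤ U) (h' : W ≤ V)
    (a : X.toSpace.presheaf.obj (op U)) : X.res h' (X.res h a) = X.res (h'.trans h) a := by
  have := X.toSpace.presheaf.map_comp (homOfLE h).op (homOfLE h').op
  exact (DFunLike.congr_fun (congrArg CommMonCat.Hom.hom this) a).symm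

theorem exists_germ_eq {x : X.toSpace} (t : X.stalk x) :
    ∃ (U : Opens X.toSpace) (hx : x ∈ U) (a : X.toSpace.presheaf.obj (op U)),
      X.germ U x hx a = t := by
  obtain ⟨j, y, h⟩ := Limits.Concrete.isColimit_exists_rep _
    (CommMonCat.FilteredColimits.colimitCoconeIsColimit.{u, u}
      ((OpenNhds.inclusion x).op ⋙ X.toSpace.presheaf)) t
  exact ⟨j.unop.1, j.unop.2, y, h⟩

theorem exists_res_eq {U : Opens X.toSpace} {x : X.toSpace} (hx : x ∈ U)
    {a b : X.toSpace.presheaf.obj (op U)} (h : X.germ U x hx a = X.germ U x hx b) :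
    ∃ (V : Opens X.toSpace) (hV : V ≤ U), x ∈ V ∧ X.res hV a = X.res hV b := by
  obtain ⟨k, f, g, e⟩ := Limits.Concrete.isColimit_exists_of_rep_eq _
    (CommMonCat.FilteredColimits.colimitCoconeIsColimit.{u, u}
      ((OpenNhds.inclusion x).op ⋙ X.toSpace.presheaf))
    (i := op ⟨U, hx⟩) (j := op ⟨U, hx⟩) a b h
  obtain rfl : f = g := Subsingleton.elim _ _
  exact ⟨k.unop.1, leOfHom f.unop, k.unop.2, e⟩

end MonoidScheme

/-! ### Charts -/

/-- The isomorphism between a monoid and the sections over the image of its spectrum under an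
open immersion. Compared with `exists_chart`, it also records bijectivity. -/
theorem exists_bijective_chart {X : MonoidalSpace.{u}} {A : CommMonCat.{u}} (j : spec A ⟶ X)
    [hj : AlgebraicGeometry.SheafedSpace.IsOpenImmersion j]
    (U : Opens X) (hU : (U : Set X) = Set.range j.hom.base) :
    ∃ e : A →* X.presheaf.obj (op U), Function.Bijective e ∧
      ∀ (a : A) (V : Opens X) (h : V ≤ U), (V : Set X) = j.hom.base '' Prime.basic a →
        Submonoid.IsLocalizationMap (Submonoid.powers (e a))
          (X.presheaf.map (homOfLE h).op).hom := by
  obtain rfl : U = hj.base_open.functor.obj ⊤ :=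
    Opens.ext (by rw [hU]; exact Set.image_univ.symm)
  have hbij : ∀ W : Opens (spec A), Function.Bijective
      (AlgebraicGeometry.PresheafedSpace.IsOpenImmersion.invApp j.hom W).hom := fun W =>
    ConcreteCategory.bijective_of_isIso
      (AlgebraicGeometry.PresheafedSpace.IsOpenImmersion.invApp j.hom W)
  refine ⟨(AlgebraicGeometry.PresheafedSpace.IsOpenImmersion.invApp j.hom ⊤).hom.comp (toSec ⊤),
    (hbij ⊤).comp toSec_top_bijective, ?_⟩
  intro a V h hV
  obtain rfl : V = hj.base_open.functor.obj (basicOpen a) := Opens.ext hV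
  refine isLocalizationMap_transport (hbij ⊤) (hbij (basicOpen a)) (fun x => ?_) _
    (sectionsRes_isLocalizationMap a)
  exact congr($(AlgebraicGeometry.PresheafedSpace.IsOpenImmersion.inv_naturality j.hom
    (homOfLE (le_top : basicOpen a ≤ ⊤)).op).hom x)

/-- The images of basic open sets under a chart are a neighbourhood basis. -/
theorem exists_basic_subset {X : MonoidalSpace.{u}} {A : CommMonCat.{u}} (j : spec A ⟶ X)
    [hj : AlgebraicGeometry.SheafedSpace.IsOpenImmersion j] (p : Prime A) (W : Opens X)
    (h : j.hom.base p ∈ W) :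
    ∃ (a : A) (V : Opens X), p ∈ Prime.basic a ∧ V ≤ W ∧
      (V : Set X) = j.hom.base '' Prime.basic a := by
  obtain ⟨_, ⟨a, rfl⟩, hpa, ha⟩ := Prime.isBasis_basic.exists_subset_of_mem_open
    (show p ∈ j.hom.base ⁻¹' (W : Set X) from h) (W.2.preimage hj.base_open.continuous)
  exact ⟨a, ⟨j.hom.base '' Prime.basic a, hj.base_open.isOpenMap _ (Prime.isOpen_basic a)⟩, hpa,
    Set.image_subset_iff.mpr ha, rfl⟩

namespace MonoidScheme

variable (X : MonoidScheme.{u})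

theorem exists_affineOpen_le {x : X.toSpace} (W : Opens X.toSpace) (hx : x ∈ W) :
    ∃ V : X.AffineOpens, x ∈ V.1 ∧ V.1 ≤ W := by
  obtain ⟨U, ⟨A, j, hj, rfl⟩, p, rfl⟩ := X.exists_affine x
  obtain ⟨a, V, hpa, hVW, hV⟩ := exists_basic_subset j p W hx
  refine ⟨⟨V, ?_⟩, ?_, hVW⟩
  · rw [hV]
    exact isAffineOpen_basic j a
  · change _ ∈ (V : Set X.toSpace)
    rw [hV]
    exact ⟨p, hpa, rfl⟩

variable {X}

/-- In a chart `spec A ≅ U`, the elements of `A` that become units in the stalk at the point of a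
prime ideal `p` are those outside of `p`, and the stalk is the localisation at these. -/
theorem exists_chart_germ {A : CommMonCat.{u}} (j : spec A ⟶ X.toSpace)
    [hj : AlgebraicGeometry.SheafedSpace.IsOpenImmersion j] (U : Opens X.toSpace)
    (hU : (U : Set X.toSpace) = Set.range j.hom.base) :
    ∃ e : A →* X.toSpace.presheaf.obj (op U), Function.Bijective e ∧
      ∀ (p : Prime A) (hp : j.hom.base p ∈ U),
        (∀ a, IsUnit (X.germ U _ hp (e a)) ↔ a ∈ p.compl) ∧
        Submonoid.IsLocalizationMap (unitLocus (X.germ U _ hp)) (X.germ U _ hp) := by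
  obtain ⟨e, hbij, hloc⟩ := exists_bijective_chart j U hU
  refine ⟨e, hbij, fun p hp => ?_⟩
  have hmem {a : A} {V : Opens X.toSpace} (hV : (V : Set X.toSpace) = j.hom.base '' Prime.basic a)
      (ha : p ∈ Prime.basic a) : j.hom.base p ∈ V := by
    change _ ∈ (V : Set X.toSpace)
    rw [hV]
    exact ⟨p, ha, rfl⟩
  have hunit : ∀ a ∈ p.compl, IsUnit (X.germ U _ hp (e a)) := by
    intro a ha
    obtain ⟨V, hV⟩ : ∃ V : Opens X.toSpace, (V : Set X.toSpace) = j.hom.base '' Prime.basic a :=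
      ⟨⟨_, hj.base_open.isOpenMap _ (Prime.isOpen_basic a)⟩, rfl⟩
    have hVU : V ≤ U := by
      rw [← SetLike.coe_subset_coe, hU, hV]
      exact Set.image_subset_range _ _
    rw [← X.germ_res hVU (hmem hV ha)]
    exact ((hloc a V hVU hV).map_units ⟨e a, 1, pow_one _⟩).map _
  have hsurj : ∀ t : X.stalk (j.hom.base p),
      ∃ s ∈ p.compl, ∃ b, t * X.germ U _ hp (e s) = X.germ U _ hp b := by
    intro t
    obtain ⟨W, hW, s, rfl⟩ := X.exists_germ_eq t
    obtain ⟨a, V, hpa, hV, hVa⟩ := exists_basic_subset j p (W ⊓ U) ⟨hW, hp⟩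
    have hVU : V ≤ U := hV.trans inf_le_right
    obtain ⟨⟨b, _, n, rfl⟩, h⟩ := (hloc a V hVU hVa).surj (X.res (hV.trans inf_le_left) s)
    refine ⟨a ^ n, pow_mem hpa n, b, ?_⟩
    have := congrArg (X.germ V _ (hmem hVa hpa)) h
    rw [map_mul, X.germ_res, X.germ_res, X.germ_res] at this
    rw [map_pow e]
    exact this
  have hinj : ∀ b c, X.germ U _ hp b = X.germ U _ hp c → ∃ s ∈ p.compl, e s * b = e s * c := by
    intro b c h
    obtain ⟨W, hWU, hW, h⟩ := X.exists_res_eq hp h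
    obtain ⟨a, V, hpa, hV, hVa⟩ := exists_basic_subset j p W hW
    have h1 := congrArg (X.res hV) h
    rw [X.res_res, X.res_res] at h1
    obtain ⟨⟨_, n, rfl⟩, h2⟩ := (hloc a V (hV.trans hWU) hVa).exists_of_eq h1
    refine ⟨a ^ n, pow_mem hpa n, ?_⟩
    rw [map_pow]
    exact h2
  refine ⟨fun a => ⟨fun h => ?_, hunit a⟩, fun y => y.2, fun t => ?_, fun {b c} h => ?_⟩
  · -- An inverse of `a` in the stalk is a fraction `b / s`, so `a * b` agrees with `s` up to a
    -- factor outside of `p`.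
    obtain ⟨t, ht⟩ := isUnit_iff_exists_inv.mp h
    obtain ⟨s, hs, b, hb⟩ := hsurj t
    obtain ⟨b, rfl⟩ := hbij.2 b
    have h1 : X.germ U _ hp (e s) = X.germ U _ hp (e (a * b)) := by
      rw [map_mul, map_mul, ← hb, ← mul_assoc, ht, one_mul]
    obtain ⟨c, hc, h2⟩ := hinj _ _ h1
    rw [← map_mul, ← map_mul] at h2
    have h3 := mul_mem hc hs
    rw [hbij.1 h2] at h3
    exact Prime.compl_of_mul_right (Prime.compl_of_mul_left h3)
  · obtain ⟨s, hs, b, h⟩ := hsurj t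
    exact ⟨⟨b, e s, hunit s hs⟩, h⟩
  · obtain ⟨s, hs, h⟩ := hinj _ _ h
    exact ⟨⟨e s, hunit s hs⟩, h⟩

/-- Over an affine open set, the stalk is the localisation of the sections at the elements that
become units. -/
theorem germ_isLocalizationMap (U : X.AffineOpens) {x : X.toSpace} (hx : x ∈ U.1) :
    Submonoid.IsLocalizationMap (unitLocus (X.germ U.1 x hx)) (X.germ U.1 x hx) := by
  obtain ⟨A, j, hj, hU⟩ := U.2
  obtain ⟨e, -, h⟩ := exists_chart_germ j U.1 hU.symm
  obtain ⟨p, rfl⟩ : x ∈ Set.range j.hom.base := hU ▸ hx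
  exact (h p hx).2

/-- Every prime ideal of the monoid of sections over an affine open set comes from a point. -/
theorem exists_point (U : X.AffineOpens) (q : Prime (X.toSpace.presheaf.obj (op U.1))) :
    ∃ (x : X.toSpace) (hx : x ∈ U.1), ∀ a, a ∈ q.compl ↔ IsUnit (X.germ U.1 x hx a) := by
  obtain ⟨A, j, hj, hU⟩ := U.2
  obtain ⟨e, hbij, h⟩ := exists_chart_germ j U.1 hU.symm
  have hx : j.hom.base (Prime.comap e q) ∈ U.1 := by
    change _ ∈ (U.1 : Set X.toSpace)
    rw [← hU]
    exact ⟨_, rfl⟩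
  refine ⟨_, hx, fun a => ?_⟩
  obtain ⟨a, rfl⟩ := hbij.2 a
  rw [(h _ hx).1, Prime.mem_comap_compl]

/-- A point of an affine open set is determined by the sections that are invertible at it. -/
theorem eq_of_isUnit_germ_iff (U : X.AffineOpens) {x y : X.toSpace} (hx : x ∈ U.1) (hy : y ∈ U.1)
    (hxy : ∀ a, IsUnit (X.germ U.1 x hx a) ↔ IsUnit (X.germ U.1 y hy a)) : x = y := by
  obtain ⟨A, j, hj, hU⟩ := U.2
  obtain ⟨e, -, h⟩ := exists_chart_germ j U.1 hU.symm
  obtain ⟨p, rfl⟩ : x ∈ Set.range j.hom.base := hU ▸ hx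
  obtain ⟨q, rfl⟩ : y ∈ Set.range j.hom.base := hU ▸ hy
  refine congrArg _ (Prime.ext (Set.ext fun a => ?_))
  have := hxy (e a)
  rw [(h p hx).1, (h q hy).1] at this
  exact not_iff_not.mp this

/-! ### Finiteness -/

theorem IsFiniteType.finite (hX : X.IsFiniteType) : Finite X.toSpace := by
  obtain ⟨n, A, j, -, hA, hcov⟩ := hX
  have (i : Fin n) : Finite (Prime (A i)) := have := hA i; finite_prime
  refine Finite.of_surjective
    (fun z : Σ i, Prime (A i) => ((j z.1).hom.base z.2 : X.toSpace)) fun x => ?_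
  obtain ⟨i, p, hp⟩ := hcov x
  exact ⟨⟨i, p⟩, hp⟩

theorem IsFiniteType.fg_stalkUnits (hX : X.IsFiniteType) (x : X.toSpace) :
    Group.FG (X.stalkUnits x) := by
  obtain ⟨n, A, j, hj, hA, hcov⟩ := hX
  obtain ⟨i, hx⟩ := hcov x
  have := hj i
  let U : X.AffineOpens := ⟨⟨Set.range (j i).hom.base, (hj i).base_open.isOpen_range⟩,
    A i, j i, hj i, rfl⟩
  obtain ⟨e, hbij, -⟩ := exists_bijective_chart (j i) U.1 rfl
  have : Monoid.FG (X.toSpace.presheaf.obj (op U.1)) :=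
    have := hA i
    Monoid.fg_of_surjective e hbij.2
  exact fg_units (germ_isLocalizationMap U (x := x) hx)

theorem IsFiniteType.exponent_spec (hX : X.IsFiniteType) : 0 < X.exponent ∧
    ∀ x, Monoid.exponent (CommGroup.torsion (X.stalkUnits x)) ∣ X.exponent := by
  have := hX.finite
  have := Fintype.ofFinite X.toSpace
  refine Nat.sInf_mem (s := {n : ℕ | 0 < n ∧
    ∀ x, Monoid.exponent (CommGroup.torsion (X.stalkUnits x)) ∣ n})
    ⟨∏ x, Monoid.exponent (CommGroup.torsion (X.stalkUnits x)), ?_, ?_⟩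
  · exact Finset.prod_pos fun x _ => have := hX.fg_stalkUnits x; exponent_torsion_pos
  · exact fun x => Finset.dvd_prod_of_mem _ (Finset.mem_univ x)

theorem IsFiniteType.finrank_le_rank (hX : X.IsFiniteType) (x : X.toSpace) :
    Module.finrank ℤ (Additive (X.stalkUnits x)) ≤ X.rank :=
  have := hX.finite
  le_ciSup (Set.finite_range fun x => Module.finrank ℤ (Additive (X.stalkUnits x))).bddAbove x

end MonoidScheme

/-! ### Points of `X_ℤ` with values in a field -/

theorem monoidRing_hom_ext {M : CommMonCat.{u}} {R : CommRingCat.{u}} {f g : monoidRing.obj M ⟶ R}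
    (h : ∀ a : M, f.hom (MonoidAlgebra.single a (1 : ℤ) : MonoidAlgebra ℤ M) =
      g.hom (MonoidAlgebra.single a (1 : ℤ) : MonoidAlgebra ℤ M)) : f = g := by
  refine CommRingCat.hom_ext ?_
  exact MonoidAlgebra.ringHom_ext' (RingHom.ext_int _ _) (MonoidHom.ext h)

/-- The homomorphism `ℤ[M] ⟶ K` given by a homomorphism from `M` to the multiplicative monoid
of `K`. -/
def monoidRingDesc {M : CommMonCat.{u}} {K : Type u} [Field K] (φ : M →* K) :
    monoidRing.obj M ⟶ CommRingCat.of K :=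
  CommRingCat.ofHom (MonoidAlgebra.liftNCRingHom (Int.castRingHom K) φ fun _ _ => Commute.all _ _)

theorem monoidRingDesc_single {M : CommMonCat.{u}} {K : Type u} [Field K] (φ : M →* K) (a : M) :
    (monoidRingDesc φ).hom (MonoidAlgebra.single a (1 : ℤ) : MonoidAlgebra ℤ M) = φ a := by
  refine (MonoidAlgebra.liftNC_single _ _ a 1).trans ?_
  simp

/-- The morphism `Spec K ⟶ Spec ℤ[M]` given by a homomorphism from `M` to the multiplicative monoid
of `K`. -/
def specPoint {M : CommMonCat.{u}} {K : Type u} [Field K] (φ : M →* K) :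
    Spec (CommRingCat.of K) ⟶ Spec (monoidRing.obj M) :=
  Spec.map (monoidRingDesc φ)

theorem specPoint_bijective {M : CommMonCat.{u}} {K : Type u} [Field K] :
    Function.Bijective (specPoint (M := M) (K := K)) := by
  constructor
  · intro φ ψ h
    ext a
    rw [← monoidRingDesc_single, Spec.map_injective h, monoidRingDesc_single]
  · intro f
    obtain ⟨g, rfl⟩ := Spec.map_surjective f
    refine ⟨MonoidHom.comp (g.hom : MonoidAlgebra ℤ M →+* K).toMonoidHom (MonoidAlgebra.of ℤ M),
      congrArg Spec.map (monoidRing_hom_ext fun a => monoidRingDesc_single _ a)⟩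

theorem specPoint_comp {M N : CommMonCat.{u}} {K : Type u} [Field K] (f : M ⟶ N) (φ : N →* K) :
    specPoint φ ≫ Spec.map (monoidRing.map f) = specPoint (φ.comp f.hom) := by
  rw [specPoint, ← Spec.map_comp]
  refine congrArg Spec.map (monoidRing_hom_ext fun a => ?_)
  rw [monoidRingDesc_single]
  refine Eq.trans (congrArg (monoidRingDesc φ).hom ?_) (monoidRingDesc_single φ (f.hom a))
  exact (MonoidAlgebra.mapDomainRingHom_apply ..).trans MonoidAlgebra.mapDomain_single

/-- A morphism from the spectrum of a field factors through every open immersion whose image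
contains the image of the point. -/
theorem exists_lift {K : Type u} [Field K] {Y Z : Scheme.{u}} (i : Z ⟶ Y)
    [AlgebraicGeometry.IsOpenImmersion i] (f : Spec (CommRingCat.of K) ⟶ Y) (z : Z)
    (h : i z = f (IsLocalRing.closedPoint K)) : ∃ g, g ≫ i = f := by
  refine ⟨AlgebraicGeometry.IsOpenImmersion.lift i f ?_,
    AlgebraicGeometry.IsOpenImmersion.lift_fac i f _⟩
  rintro _ ⟨y, rfl⟩
  exact ⟨z, h.trans (congrArg f (Subsingleton.elim (α := PrimeSpectrum K) _ y))⟩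

namespace MonoidScheme

variable {X : MonoidScheme.{u}} {K : Type u} [Field K]

/-- Every homomorphism from the sections over an affine open set to `K` is given by a point and a
character of the unit group of its stalk. -/
theorem exists_evalHom_germ_eq (U : X.AffineOpens) (φ : X.toSpace.presheaf.obj (op U.1) →* K) :
    ∃ (x : X.toSpace) (hx : x ∈ U.1) (χ : X.stalkUnits x →* Kˣ),
      evalHom (X.germ U.1 x hx) χ = φ := by
  obtain ⟨x, hx, h⟩ := exists_point U (zeroLocus φ)
  exact ⟨x, hx, exists_evalHom_eq (germ_isLocalizationMap U hx) φ h⟩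

theorem evalHom_germ_injective (U : X.AffineOpens) {x y : X.toSpace} (hx : x ∈ U.1) (hy : y ∈ U.1)
    {χ : X.stalkUnits x →* Kˣ} {ψ : X.stalkUnits y →* Kˣ}
    (h : evalHom (X.germ U.1 x hx) χ = evalHom (X.germ U.1 y hy) ψ) :
    (⟨x, χ⟩ : Σ x : X.toSpace, X.stalkUnits x →* Kˣ) = ⟨y, ψ⟩ := by
  obtain rfl : x = y := eq_of_isUnit_germ_iff U hx hy fun a => by
    rw [← evalHom_ne_zero_iff (χ := χ), h, evalHom_ne_zero_iff]
  rw [evalHom_injective (germ_isLocalizationMap U hx) h]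

/-- The open immersion of `Spec ℤ[𝒪(U)]` into `X_ℤ`. -/
def ι (U : X.AffineOpens) : X.affineDiagram.obj U ⟶ X.ascent :=
  Limits.colimit.ι X.affineDiagram U

instance (U : X.AffineOpens) : AlgebraicGeometry.IsOpenImmersion (ι U) :=
  inferInstanceAs (AlgebraicGeometry.IsOpenImmersion (Limits.colimit.ι X.affineDiagram U))

theorem ι_w {U V : X.AffineOpens} (i : V ⟶ U) : X.affineDiagram.map i ≫ ι U = ι V :=
  Limits.colimit.w X.affineDiagram i

/-- The `K`-valued point of the chart `Spec ℤ[𝒪(U)]` that belongs to a point of `U` and a character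
of the unit group of its stalk. -/
def chartPoint (U : X.AffineOpens) {x : X.toSpace} (hx : x ∈ U.1) (χ : X.stalkUnits x →* Kˣ) :
    Spec (CommRingCat.of K) ⟶ X.affineDiagram.obj U :=
  specPoint (evalHom (X.germ U.1 x hx) χ)

theorem chartPoint_map {U V : X.AffineOpens} (i : V ⟶ U) {x : X.toSpace} (hx : x ∈ V.1)
    (χ : X.stalkUnits x →* Kˣ) :
    chartPoint V hx χ ≫ X.affineDiagram.map i = chartPoint U (leOfHom i hx) χ := by
  refine (specPoint_comp _ _).trans ?_
  rw [evalHom_comp]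
  exact congrArg (fun g => specPoint (evalHom g χ)) (X.germ_comp_res (leOfHom i) hx)

theorem chartPoint_injective (U : X.AffineOpens) {x y : X.toSpace} (hx : x ∈ U.1) (hy : y ∈ U.1)
    {χ : X.stalkUnits x →* Kˣ} {ψ : X.stalkUnits y →* Kˣ}
    (h : chartPoint U hx χ = chartPoint U hy ψ) :
    (⟨x, χ⟩ : Σ x : X.toSpace, X.stalkUnits x →* Kˣ) = ⟨y, ψ⟩ :=
  evalHom_germ_injective U hx hy (specPoint_bijective.1 h)

theorem exists_chartPoint_eq (U : X.AffineOpens)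
    (f : Spec (CommRingCat.of K) ⟶ X.affineDiagram.obj U) :
    ∃ (x : X.toSpace) (hx : x ∈ U.1) (χ : X.stalkUnits x →* Kˣ), chartPoint U hx χ = f := by
  obtain ⟨φ, hφ⟩ := specPoint_bijective.2 f
  obtain ⟨x, hx, χ, rfl⟩ := exists_evalHom_germ_eq U φ
  exact ⟨x, hx, χ, hφ⟩

/-- The `K`-valued point of `X_ℤ` in the chart `Spec ℤ[𝒪(U)]` that belongs to a point of `X` and a
character of the unit group of its stalk. -/
def pointIn (U : X.AffineOpens) {x : X.toSpace} (hx : x ∈ U.1) (χ : X.stalkUnits x →* Kˣ) :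
    Spec (CommRingCat.of K) ⟶ X.ascent :=
  chartPoint U hx χ ≫ ι U

theorem pointIn_of_le {U V : X.AffineOpens} (h : V ≤ U) {x : X.toSpace} (hx : x ∈ V.1)
    (χ : X.stalkUnits x →* Kˣ) : pointIn U (h hx) χ = pointIn V hx χ := by
  rw [pointIn, pointIn, ← ι_w (homOfLE h), ← Category.assoc, chartPoint_map]

theorem pointIn_eq_pointIn (U V : X.AffineOpens) {x : X.toSpace} (hU : x ∈ U.1) (hV : x ∈ V.1)
    (χ : X.stalkUnits x →* Kˣ) : pointIn U hU χ = pointIn V hV χ := by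
  obtain ⟨W, hx, hW⟩ := X.exists_affineOpen_le (U.1 ⊓ V.1) ⟨hU, hV⟩
  rw [pointIn_of_le (show W ≤ U from hW.trans inf_le_left) hx,
    pointIn_of_le (show W ≤ V from hW.trans inf_le_right) hx]

variable (X K) in
/-- The `K`-valued point of `X_ℤ` that belongs to a point `x` of `X` and a character of the unit
group of its stalk. It is defined through a chosen affine open neighbourhood of `x`; by `toPoint_eq`
every other one gives the same point. -/
def toPoint (z : Σ x : X.toSpace, X.stalkUnits x →* Kˣ) : Spec (CommRingCat.of K) ⟶ X.ascent :=
  pointIn (X.exists_affineOpen_le ⊤ (Opens.mem_top z.1)).choose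
    (X.exists_affineOpen_le ⊤ (Opens.mem_top z.1)).choose_spec.1 z.2

theorem toPoint_eq (U : X.AffineOpens) {x : X.toSpace} (hx : x ∈ U.1) (χ : X.stalkUnits x →* Kˣ) :
    toPoint X K ⟨x, χ⟩ = pointIn U hx χ := pointIn_eq_pointIn _ _ _ _ _

theorem toPoint_surjective : Function.Surjective (toPoint X K) := by
  intro f
  obtain ⟨U, z, hz⟩ := Scheme.IsLocallyDirected.ι_jointly_surjective X.affineDiagram
    (f (IsLocalRing.closedPoint K))
  obtain ⟨g, rfl⟩ := exists_lift (ι U) f z hz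
  obtain ⟨x, hx, χ, rfl⟩ := exists_chartPoint_eq U g
  exact ⟨⟨x, χ⟩, toPoint_eq U hx χ⟩

theorem toPoint_injective : Function.Injective (toPoint X K) := by
  rintro ⟨x, χ⟩ ⟨y, ψ⟩ h
  obtain ⟨U, hx, -⟩ := X.exists_affineOpen_le ⊤ (Opens.mem_top x)
  obtain ⟨V, hy, -⟩ := X.exists_affineOpen_le ⊤ (Opens.mem_top y)
  rw [toPoint_eq U hx, toPoint_eq V hy] at h
  -- The two points lie in a common chart `W`, where they are given by the same morphism.
  obtain ⟨W, i, j, w, hi, hj⟩ := (Scheme.IsLocallyDirected.ι_eq_ι_iff X.affineDiagram).mp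
    (congr($h (IsLocalRing.closedPoint K)))
  obtain ⟨f, hf⟩ := exists_lift (X.affineDiagram.map i) _ w hi
  obtain ⟨g, hg⟩ := exists_lift (X.affineDiagram.map j) _ w hj
  have hfg : f = g := by
    rw [← cancel_mono (ι W)]
    calc f ≫ ι W = (f ≫ X.affineDiagram.map i) ≫ ι U := by rw [Category.assoc, ι_w]
      _ = (g ≫ X.affineDiagram.map j) ≫ ι V := by rw [hf, hg]; exact h
      _ = g ≫ ι W := by rw [Category.assoc, ι_w]
  obtain ⟨z, hz, ω, rfl⟩ := exists_chartPoint_eq W f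
  rw [← hfg, chartPoint_map] at hg
  rw [chartPoint_map] at hf
  exact (chartPoint_injective U _ hx hf).symm.trans (chartPoint_injective V _ hy hg)

variable (X K) in
/-- `X_ℤ(K)` is the disjoint union, over the points `x` of `X`, of the groups of homomorphisms
from `𝒪_{X,x}ˣ` to `Kˣ`. -/
theorem toPoint_bijective : Function.Bijective (toPoint X K) :=
  ⟨toPoint_injective, toPoint_surjective⟩

theorem IsFiniteType.finite_points (hX : X.IsFiniteType) [Finite K] :
    Finite (Spec (CommRingCat.of K) ⟶ X.ascent) := by
  have := hX.finite
  have (x : X.toSpace) : Finite (X.stalkUnits x →* Kˣ) :=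
    have := hX.fg_stalkUnits x
    finite_monoidHom
  exact Finite.of_surjective _ (toPoint_surjective (X := X) (K := K))

/-! ### The zeta-polynomial -/

variable (X) in
/-- The zeta-polynomial `∑ (T - 1) ^ r(x)`, where `x` runs through the points of `X` and `r(x)` is
the rank of the unit group of the stalk at `x`. It is only meaningful if `X` is finite. -/
def zetaPolynomial : Polynomial ℤ :=
  ∑ᶠ x : X.toSpace, (Polynomial.X - 1) ^ Module.finrank ℤ (Additive (X.stalkUnits x))

theorem IsFiniteType.natDegree_zetaPolynomial_le (hX : X.IsFiniteType) :
    X.zetaPolynomial.natDegree ≤ X.rank := by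
  have := hX.finite
  have := Fintype.ofFinite X.toSpace
  rw [zetaPolynomial, finsum_eq_sum_of_fintype]
  refine Polynomial.natDegree_sum_le_of_forall_le _ _ fun x _ => ?_
  refine Polynomial.natDegree_pow_le.trans ?_
  rw [← Polynomial.C_1, Polynomial.natDegree_X_sub_C, mul_one]
  exact hX.finrank_le_rank x

theorem IsFiniteType.countsPoints (hX : X.IsFiniteType) :
    CountsPoints X.ascent X.exponent X.zetaPolynomial := by
  intro q hq hcop K _ hK
  have := hX.finite
  have := Fintype.ofFinite X.toSpace
  have : Finite K := Nat.finite_of_card_ne_zero (hK ▸ hq.pos.ne')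
  have hunits : Nat.card Kˣ = q - 1 := by rw [Nat.card_units, hK]
  have (x : X.toSpace) : Finite (X.stalkUnits x →* Kˣ) :=
    have := hX.fg_stalkUnits x
    finite_monoidHom
  have hcard : ∀ x : X.toSpace, Nat.card (X.stalkUnits x →* Kˣ) =
      (q - 1) ^ Module.finrank ℤ (Additive (X.stalkUnits x)) := fun x => by
    have := hX.fg_stalkUnits x
    rw [card_monoidHom (hX.exponent_spec.2 x) (by rwa [hunits]), hunits]
  rw [← Nat.card_congr (Equiv.ofBijective _ (toPoint_bijective X K)), Nat.card_sigma,
    zetaPolynomial, finsum_eq_sum_of_fintype, Polynomial.eval_finsetSum, Nat.cast_sum]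
  refine Finset.sum_congr rfl fun x _ => ?_
  rw [hcard]
  simp [Nat.cast_sub hq.one_lt.le]

end MonoidScheme

/-- Two polynomials that count points agree at the infinitely many powers `q` of `2` for which
`q - 1` is prime to `e * e'`. -/
theorem CountsPoints.unique {Y : Scheme.{u}} {e e' : ℕ} {N N' : Polynomial ℤ} (he : 0 < e)
    (he' : 0 < e') (h : CountsPoints Y e N) (h' : CountsPoints Y e' N') : N' = N := by
  refine Polynomial.eq_of_infinite_eval_eq _ _ ?_
  refine Set.infinite_of_forall_exists_gt fun b => ?_
  obtain ⟨n, hn, hn0, hcop⟩ := exists_two_pow_coprime (Nat.mul_pos he he') b.toNat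
  have hcard : Nat.card (ULift.{u} (GaloisField 2 n)) = 2 ^ n := by
    rw [Nat.card_ulift, GaloisField.card 2 n hn0]
  have hq : IsPrimePow (2 ^ n) := Nat.prime_two.isPrimePow.pow hn0
  refine ⟨((2 ^ n : ℕ) : ℤ), ?_, ?_⟩
  · exact (h' _ hq (Nat.Coprime.coprime_mul_left_right hcop) _ hcard).symm.trans
      (h _ hq (Nat.Coprime.coprime_mul_right_right hcop) _ hcard)
  · have : n < 2 ^ n := Nat.lt_two_pow_self
    omega

end FOne

end

theorem theorem1 (X : FOne.MonoidScheme.{u}) (hX : X.IsFiniteType) :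
    (∀ (K : Type u) [Field K] [Finite K],
      Finite (AlgebraicGeometry.Spec (CommRingCat.of K) ⟶ X.ascent)) ∧
    0 < X.exponent ∧
    ∃ N : Polynomial ℤ,
      FOne.CountsPoints X.ascent X.exponent N ∧
      N.natDegree ≤ X.rank ∧
      ∀ (e : ℕ) (N' : Polynomial ℤ), 0 < e → FOne.CountsPoints X.ascent e N' → N' = N :=
  ⟨fun _ _ _ => hX.finite_points, hX.exponent_spec.1, X.zetaPolynomial, hX.countsPoints,
    hX.natDegree_zetaPolynomial_le, fun _ _ he h =>
      hX.countsPoints.unique hX.exponent_spec.1 he h⟩
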